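/- **Lemma 5.2 (rigidity).** Let $M$ be a $K3$ surface with a hyperkähler structure: a compact, connected, simply connected smooth $4$-manifold with a Riemannian metric $g$ and orthogonal almost complex structures $I,J,K=IJ=-JI$ whose fundamental forms $\kappa_I=g(I\cdot,\cdot)$, $\kappa_J=g(J\cdot,\cdot)$, $\kappa_K=g(K\cdot,\cdot)$ are smooth and closed (so $\kappa_I$ is the Kähler form and $\kappa_J+i\kappa_K$ the holomorphic $(2,0)$-form). A surface in $M$ (an embedded $2$-dimensional submanifold without boundary) is *special Lagrangian* if $\kappa_I$ and $\kappa_K$ vanish on it. Let $a<b$, let $\theta$ and $t$ be the coordinates on $S^1$ and $\mathbb R$, and give $M\times S^1\times\mathbb R$ the forms $$\omega=\kappa_I+dt\wedge d\theta,\qquad \Omega=(\kappa_J+i\kappa_K)\wedge(dt+i\,d\theta).$$ A $3$-dimensional embedded submanifold, possibly with boundary, is *special Lagrangian* if $\omega$ and $\operatorname{Im}\Omega$ vanish on it; it is then oriented by $\operatorname{Re}\Omega$. Put $X=M\times S^1\times[a,b]$, let $p\in S^1$, and let $N\subset M$ be such that $L=N\times\{p\}\times[a,b]$ is special Lagrangian.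 Let $\tilde L\subset X$ be a compact special Lagrangian whose boundary lies in $A=M\times\{p\}\times\{a,b\}$ and which is homologous to $L$, that is, $[\tilde L]=[L]$ in $H_3(X,A;\mathbb Z)$. Here homology is smooth singular (cubical) homology. (In particular, $\tilde L$ may be any compact special Lagrangian with $\partial\tilde L=\partial L$ such that $\tilde L-L$ bounds a chain in $X$.) Then $$\tilde L=\tilde N\times\{p\}\times[a,b]$$ for some special Lagrangian surface $\tilde N$ in $M$. -/

import Mathlib

open scoped Manifold ContDiff

noncomputable section

/-! ### Submanifolds of a manifold without boundary -/

section Submanifolds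

variable {E : Type*} [NormedAddCommGroup E] [NormedSpace ℝ E]
  {H : Type*} [TopologicalSpace H] (I : ModelWithCorners ℝ E H)
  {Z : Type*} [TopologicalSpace Z] [ChartedSpace H Z]

/-- Near `x`, the set `S` is a `k`-dimensional slice: some smooth chart of the ambient manifold
around `x` identifies `S` with a `k`-dimensional linear subspace. -/
def IsSliceAt (k : ℕ) (S : Set Z) (x : Z) : Prop :=
  ∃ φ ∈ IsManifold.maximalAtlas I ∞ Z, x ∈ φ.source ∧
    ∃ V : Submodule ℝ E, Module.finrank ℝ V = k ∧
      ∀ y ∈ φ.source, (y ∈ S ↔ φ.extend I y ∈ V)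

/-- Near `x`, the set `S` is a `k`-dimensional half-slice and `x` lies on its edge: some smooth
chart of the ambient manifold around `x` identifies `S` with a closed half-space of a
`k`-dimensional linear subspace, and sends `x` into the bounding hyperplane. -/
def IsHalfSliceAt (k : ℕ) (S : Set Z) (x : Z) : Prop :=
  ∃ φ ∈ IsManifold.maximalAtlas I ∞ Z, x ∈ φ.source ∧
    ∃ V : Submodule ℝ E, Module.finrank ℝ V = k ∧
      ∃ ℓ : E →L[ℝ] ℝ, (∃ v ∈ V, ℓ v ≠ 0) ∧ ℓ (φ.extend I x) = 0 ∧
        ∀ y ∈ φ.source, (y ∈ S ↔ φ.extend I y ∈ V ∧ 0 ≤ ℓ (φ.extend I y))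

/-- Embedded smooth `k`-dimensional submanifolds (without boundary). -/
def IsSubmanifold (k : ℕ) (S : Set Z) : Prop :=
  ∀ x ∈ S, IsSliceAt I k S x

/-- Embedded smooth `k`-dimensional submanifolds with (possibly empty) boundary. -/
def IsSubmanifoldWithBoundary (k : ℕ) (S : Set Z) : Prop :=
  ∀ x ∈ S, IsSliceAt I k S x ∨ IsHalfSliceAt I k S x

/-- The manifold boundary of a submanifold with boundary. -/
def submanifoldBoundary (k : ℕ) (S : Set Z) : Set Z :=
  {x ∈ S | IsHalfSliceAt I k S x}

/-- The tangent space at `x` of a subset `S` of a manifold: the span of all limits of rescaled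
secant directions of `S` at `x`, computed in the preferred chart at `x` (which is the chart that
identifies `TangentSpace I x` with the model space). For a submanifold with or without boundary
this is its usual tangent space (at a boundary point, the full one). -/
def tangentSpaceOf (S : Set Z) (x : Z) : Submodule ℝ (TangentSpace I x) :=
  Submodule.span ℝ
    (tangentConeAt ℝ (extChartAt I x '' (S ∩ (extChartAt I x).source)) (extChartAt I x x) : Set E)

end Submanifolds

/-! ### Smooth singular cubical homology -/

section Cubes

variable {E : Type*} [NormedAddCommGroup E] [NormedSpace ℝ E]
  {H : Type*} [TopologicalSpace H] (I : ModelWithCorners ℝ E H)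
  {Z : Type*} [TopologicalSpace Z] [ChartedSpace H Z]

/-- The map `ℝ^k → Z` that agrees with `σ` on the unit cube (coordinates outside `[0,1]` are
clamped). -/
def cubeExtend {k : ℕ} (σ : (Fin k → unitInterval) → Z) (y : Fin k → ℝ) : Z :=
  σ fun i => Set.projIcc 0 1 zero_le_one (y i)

/-- `σ` is smooth on the closed unit cube (one-sided derivatives at its faces). -/
def IsSmoothCube {k : ℕ} (σ : (Fin k → unitInterval) → Z) : Prop :=
  ContMDiffOn 𝓘(ℝ, Fin k → ℝ) I ∞ (cubeExtend σ) (Set.Icc 0 1)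

/-- The `i`-th partial derivative of a cube. -/
def cubePartial {k : ℕ} (σ : (Fin k → unitInterval) → Z) (y : Fin k → ℝ) (i : Fin k) :
    TangentSpace I (cubeExtend σ y) :=
  mfderivWithin 𝓘(ℝ, Fin k → ℝ) I (cubeExtend σ) (Set.Icc 0 1) y
    (Pi.single i (1 : ℝ) : Fin k → ℝ)

/-- The face of a cube on which the `i`-th coordinate equals `e`. -/
def cubeFace {k : ℕ} (σ : (Fin (k + 1) → unitInterval) → Z) (i : Fin (k + 1))
    (e : unitInterval) : (Fin k → unitInterval) → Z :=
  fun x => σ (i.insertNth e x)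

/-- Integral chains on maps of the unit `k`-cube into `Z`. -/
abbrev CubeChain (Z : Type*) (k : ℕ) : Type _ := ((Fin k → unitInterval) → Z) →₀ ℤ

/-- The cubical boundary operator. -/
def cubeBoundary {k : ℕ} (c : CubeChain Z (k + 1)) : CubeChain Z k :=
  c.sum fun σ m => ∑ i : Fin (k + 1),
    (-1 : ℤ) ^ (i : ℕ) • (Finsupp.single (cubeFace σ i 1) m - Finsupp.single (cubeFace σ i 0) m)

/-- The smooth singular cubical `k`-chains in a subset `U`. -/
def smoothChains (U : Set Z) (k : ℕ) : AddSubgroup (CubeChain Z k) :=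
  AddSubgroup.closure {c | ∃ σ : (Fin k → unitInterval) → Z,
    IsSmoothCube I σ ∧ Set.range σ ⊆ U ∧ c = Finsupp.single σ 1}

/-- The degenerate chains, generated by the cubes that do not depend on one of their
coordinates; in singular cubical homology they count as zero. -/
def degenerateChains (Z : Type*) (k : ℕ) : AddSubgroup (CubeChain Z k) :=
  AddSubgroup.closure {c | ∃ σ : (Fin k → unitInterval) → Z,
    (∃ i : Fin k, ∀ x e, σ (Function.update x i e) = σ x) ∧ c = Finsupp.single σ 1}

/-- `c` is a fundamental chain of the compact `k`-dimensional submanifold with boundary `S`,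
oriented by declaring a basis `v` of a tangent space to be positive when `0 < o x v`:
`c` cuts `S` into finitely many smoothly embedded cubes with pairwise disjoint interiors, each one
with the coefficient `1` or `-1` according to its orientation, and the boundary of `c` lies in the
boundary of `S`. -/
def IsFundamentalChain (k : ℕ) (o : ∀ x : Z, (Fin (k + 1) → TangentSpace I x) → ℝ) (S : Set Z)
    (c : CubeChain Z (k + 1)) : Prop :=
  (∀ σ ∈ c.support, IsSmoothCube I σ ∧ Function.Injective σ ∧ (c σ = 1 ∨ c σ = -1) ∧
    ∀ y ∈ Set.Icc (0 : Fin (k + 1) → ℝ) 1,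
      0 < (c σ : ℝ) * o (cubeExtend σ y) (cubePartial I σ y)) ∧
  (∀ σ ∈ c.support, ∀ τ ∈ c.support, σ ≠ τ →
    Disjoint (σ '' {x | ∀ i, 0 < x i ∧ x i < 1}) (τ '' {x | ∀ i, 0 < x i ∧ x i < 1})) ∧
  (⋃ σ ∈ c.support, Set.range σ) = S ∧
  cubeBoundary c ∈ smoothChains I (submanifoldBoundary I (k + 1) S) k ⊔ degenerateChains Z k

/-- The compact `(k+1)`-dimensional submanifolds with boundary `S` and `S'` of `X`, oriented by
`o` and with boundaries in `A`, are homologous in `X` relative to `A`: the difference of their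
fundamental chains is the boundary of a chain in `X`, up to a chain in `A`. Thus
`[S] = [S']` in `H_{k+1}(X, A; ℤ)`. -/
def HomologousRel (k : ℕ) (o : ∀ x : Z, (Fin (k + 1) → TangentSpace I x) → ℝ) (X A S S' : Set Z) :
    Prop :=
  S ⊆ X ∧ S' ⊆ X ∧ submanifoldBoundary I (k + 1) S ⊆ A ∧ submanifoldBoundary I (k + 1) S' ⊆ A ∧
  ∃ c c' : CubeChain Z (k + 1), IsFundamentalChain I k o S c ∧ IsFundamentalChain I k o S' c' ∧
    ∃ W ∈ smoothChains I X (k + 2),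
      c' - c - cubeBoundary W ∈ smoothChains I A (k + 1) ⊔ degenerateChains Z (k + 1)

end Cubes

/-! ### Hyperkähler surfaces -/

section Hyperkahler

variable (M : Type*) [TopologicalSpace M] [ChartedSpace (EuclideanSpace ℝ (Fin 4)) M]

/-- Real 2-forms on a 4-manifold (no regularity imposed). -/
abbrev TwoForm : Type _ := ∀ x : M, TangentSpace (𝓡 4) x [⋀^Fin 2]→L[ℝ] ℝ

variable {M}

/-- The expression of a 2-form in the preferred chart around `x₀`, that is, its pull-back under
the inverse of the chart. -/
def TwoForm.inChart (κ : TwoForm M) (x₀ : M) (y : EuclideanSpace ℝ (Fin 4)) :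
    EuclideanSpace ℝ (Fin 4) [⋀^Fin 2]→L[ℝ] ℝ :=
  (κ ((extChartAt (𝓡 4) x₀).symm y)).compContinuousLinearMap
    (mfderiv 𝓘(ℝ, EuclideanSpace ℝ (Fin 4)) (𝓡 4) (extChartAt (𝓡 4) x₀).symm y)

/-- A 2-form is smooth if it is so in all charts. -/
def TwoForm.IsSmooth (κ : TwoForm M) : Prop :=
  ∀ x₀ : M, ContDiffOn ℝ ∞ (κ.inChart x₀) (extChartAt (𝓡 4) x₀).target

/-- A 2-form is closed if its exterior derivative vanishes in all charts. -/
def TwoForm.IsClosed (κ : TwoForm M) : Prop :=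
  ∀ x₀ : M, ∀ y ∈ (extChartAt (𝓡 4) x₀).target, extDeriv (κ.inChart x₀) y = 0

variable (M) in
/-- A hyperkähler structure on a 4-manifold: a Riemannian metric `g`, orthogonal almost complex
structures `I`, `J`, `K = I J = - J I`, and their fundamental 2-forms
`κI = g(I·,·)`, `κJ = g(J·,·)`, `κK = g(K·,·)`, which are smooth and closed. By Hitchin's lemma
closedness makes `I`, `J`, `K` integrable and parallel; `κI` is the Kähler form and
`κJ + i κK` is a holomorphic (2,0)-form for the complex structure `I`. -/
structure HyperkahlerStructure [IsManifold (𝓡 4) ∞ M] where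
  g : Bundle.ContMDiffRiemannianMetric (𝓡 4) ∞ (EuclideanSpace ℝ (Fin 4))
    (fun x : M => TangentSpace (𝓡 4) x)
  I : ∀ x : M, TangentSpace (𝓡 4) x →L[ℝ] TangentSpace (𝓡 4) x
  J : ∀ x : M, TangentSpace (𝓡 4) x →L[ℝ] TangentSpace (𝓡 4) x
  K : ∀ x : M, TangentSpace (𝓡 4) x →L[ℝ] TangentSpace (𝓡 4) x
  I_sq : ∀ x v, I x (I x v) = -v
  J_sq : ∀ x v, J x (J x v) = -v
  I_J : ∀ x v, I x (J x v) = K x v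
  J_I : ∀ x v, J x (I x v) = -K x v
  I_orthogonal : ∀ x u v, g.inner x (I x u) (I x v) = g.inner x u v
  J_orthogonal : ∀ x u v, g.inner x (J x u) (J x v) = g.inner x u v
  κI : TwoForm M
  κJ : TwoForm M
  κK : TwoForm M
  κI_apply : ∀ x u v, κI x ![u, v] = g.inner x (I x u) v
  κJ_apply : ∀ x u v, κJ x ![u, v] = g.inner x (J x u) v
  κK_apply : ∀ x u v, κK x ![u, v] = g.inner x (K x u) v
  smooth_κI : κI.IsSmooth
  smooth_κJ : κJ.IsSmooth
  smooth_κK : κK.IsSmooth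
  closed_κI : κI.IsClosed
  closed_κJ : κJ.IsClosed
  closed_κK : κK.IsClosed

variable [IsManifold (𝓡 4) ∞ M]

/-- Special Lagrangian surfaces (without boundary) in `M`: the Kähler form `κI` and the imaginary
part `κK` of the holomorphic 2-form `κJ + i κK` vanish on all tangent spaces. -/
def IsSpecialLagrangianSurface (h : HyperkahlerStructure M) (N : Set M) : Prop :=
  IsSubmanifold (𝓡 4) 2 N ∧
    ∀ x ∈ N, ∀ u ∈ tangentSpaceOf (𝓡 4) N x, ∀ v ∈ tangentSpaceOf (𝓡 4) N x,
      h.κI x ![u, v] = 0 ∧ h.κK x ![u, v] = 0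

/-! ### The cylinder `M × S¹ × ℝ` -/

/-- The model with corners of `M × S¹ × ℝ` (all factors are boundaryless). -/
abbrev cylModel : ModelWithCorners ℝ
    (EuclideanSpace ℝ (Fin 4) × EuclideanSpace ℝ (Fin 1) × ℝ)
    (ModelProd (EuclideanSpace ℝ (Fin 4)) (ModelProd (EuclideanSpace ℝ (Fin 1)) ℝ)) :=
  (𝓡 4).prod ((𝓡 1).prod 𝓘(ℝ, ℝ))

/-- The component along `M` of a tangent vector of the cylinder. -/
def cylProj (z : M × Circle × ℝ) (u : TangentSpace cylModel z) : TangentSpace (𝓡 4) z.1 :=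
  mfderiv cylModel (𝓡 4) (Prod.fst : M × Circle × ℝ → M) z u

/-- The 1-form `dt` on the cylinder. -/
def cylDt (z : M × Circle × ℝ) (u : TangentSpace cylModel z) : ℝ :=
  mfderiv cylModel 𝓘(ℝ, ℝ) (fun w : M × Circle × ℝ => w.2.2) z u

/-- The 1-form `dθ` on the cylinder: since `ζ = exp (iθ)` on the unit circle, it is the imaginary
part of `ζ⁻¹ dζ`. -/
def cylDθ (z : M × Circle × ℝ) (u : TangentSpace cylModel z) : ℝ :=
  let dζ : ℂ := mfderiv cylModel 𝓘(ℝ, ℂ) (fun w : M × Circle × ℝ => (w.2.1 : ℂ)) z u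
  ((z.2.1 : ℂ)⁻¹ * dζ).im

/-- The Kähler form `ω = κI + dt ∧ dθ` of the cylinder. -/
def cylKahlerForm (h : HyperkahlerStructure M) (z : M × Circle × ℝ)
    (u v : TangentSpace cylModel z) : ℝ :=
  h.κI z.1 ![cylProj z u, cylProj z v] + (cylDt z u * cylDθ z v - cylDt z v * cylDθ z u)

/-- The holomorphic volume form `Ω = (κJ + i κK) ∧ (dt + i dθ)` of the cylinder. -/
def cylVolumeForm (h : HyperkahlerStructure M) (z : M × Circle × ℝ)
    (v : Fin 3 → TangentSpace cylModel z) : ℂ :=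
  let κ : Fin 3 → Fin 3 → ℂ := fun i j =>
    (h.κJ z.1 ![cylProj z (v i), cylProj z (v j)] : ℂ) +
      Complex.I * (h.κK z.1 ![cylProj z (v i), cylProj z (v j)] : ℂ)
  let α : Fin 3 → ℂ := fun i => (cylDt z (v i) : ℂ) + Complex.I * (cylDθ z (v i) : ℂ)
  κ 0 1 * α 2 - κ 0 2 * α 1 + κ 1 2 * α 0

/-- Special Lagrangian threefolds, possibly with boundary, in the cylinder: `ω` and `Im Ω` vanish
on all tangent spaces. -/
def IsSpecialLagrangianThreefold (h : HyperkahlerStructure M) (S : Set (M × Circle × ℝ)) : Prop :=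
  IsSubmanifoldWithBoundary cylModel 3 S ∧
    ∀ z ∈ S, ∀ v : Fin 3 → TangentSpace cylModel z, (∀ i, v i ∈ tangentSpaceOf cylModel S z) →
      cylKahlerForm h z (v 0) (v 1) = 0 ∧ (cylVolumeForm h z v).im = 0

/-- `Re Ω`; its restriction to a special Lagrangian is nowhere zero and gives the canonical
orientation. -/
def cylReΩ (h : HyperkahlerStructure M) (z : M × Circle × ℝ)
    (v : Fin 3 → TangentSpace cylModel z) : ℝ :=
  (cylVolumeForm h z v).re

end Hyperkahler

end

/-!
The proof is a calibration argument with the closed 3-form `η = κK ∧ dθ` in place of the volume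
form. It vanishes on `A` and on `N × {p} × [a, b]`, on both of which `θ` is constant, so Stokes'
theorem for smooth cubes gives `∫ η = 0` over the fundamental chain of `L'`
(`chainIntegral_eq_zero`).

On the other hand `η` has a sign on special Lagrangians
(`HyperkahlerStructure.neg_κK_wedge_dθ_mul_nonneg`): `Re Ω = κJ ∧ dt - κK ∧ dθ`, and if `ω` and
`Im Ω` vanish on a tangent space, quaternionic linear algebra shows that `-η` has there the same
sign as `Re Ω` and that it vanishes only if `dθ` does. Since the cubes of a fundamental chain are
oriented by `Re Ω`, it follows that `dθ = 0` on all tangent spaces of `L'`; as a `κI`-isotropic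
subspace of the tangent space of `M` is at most two-dimensional, such a tangent space contains `∂t`
(`exists_tangent_basis_of_chainIntegral_eq_zero`).

A submanifold that is tangent to `∂t` is locally invariant under the flow of `∂t` away from its
boundary (`eventually_cylShift_mem`). As `L'` is compact and has its boundary in
`M × {p} × {a, b}`, it is a union of segments `{(x, p)} × [a, b]`
(`segment_subset_of_cylVertical_mem`). Its section `N'` at an interior time is a surface: by the
inverse function theorem, projecting a slice chart of `L'` along `∂t` yields a slice chart of `N'`
(`isSliceAt_crossSection`). Finally, `ω` restricts to `κI` on `N'`, and the contraction of `Im Ω`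
with `∂t` to `κK`, so that both forms vanish on `N'`.
-/

open Set Topology MeasureTheory

/-! ### Quaternionic linear algebra of a hyperkähler tangent space -/

namespace HyperkahlerStructure

variable {M : Type*} [TopologicalSpace M] [ChartedSpace (EuclideanSpace ℝ (Fin 4)) M]
  [IsManifold (𝓡 4) ∞ M] (h : HyperkahlerStructure M) (x : M)

theorem inner_I_left (u v : TangentSpace (𝓡 4) x) :
    h.g.inner x (h.I x u) v = -h.g.inner x u (h.I x v) := by
  rw [← h.I_orthogonal x u (h.I x v), h.I_sq]; simp

theorem inner_J_left (u v : TangentSpace (𝓡 4) x) :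
    h.g.inner x (h.J x u) v = -h.g.inner x u (h.J x v) := by
  rw [← h.J_orthogonal x u (h.J x v), h.J_sq]; simp

theorem I_K (u : TangentSpace (𝓡 4) x) : h.I x (h.K x u) = -h.J x u := by
  rw [← h.I_J, h.I_sq]

theorem K_J (u : TangentSpace (𝓡 4) x) : h.K x (h.J x u) = -h.I x u := by
  rw [← h.I_J, h.J_sq, map_neg]

theorem K_I (u : TangentSpace (𝓡 4) x) : h.K x (h.I x u) = h.J x u := by
  rw [← h.I_J, h.J_I, map_neg, h.I_K, neg_neg]

theorem J_K (u : TangentSpace (𝓡 4) x) : h.J x (h.K x u) = h.I x u := by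
  rw [← h.I_J, h.J_I, h.K_J, neg_neg]

theorem K_sq (u : TangentSpace (𝓡 4) x) : h.K x (h.K x u) = -u := by
  rw [← h.I_J, h.J_K, h.I_sq]

theorem inner_K_left (u v : TangentSpace (𝓡 4) x) :
    h.g.inner x (h.K x u) v = -h.g.inner x u (h.K x v) := by
  rw [← h.I_J, h.inner_I_left, h.inner_J_left, h.J_I]; simp

theorem inner_I_self (u : TangentSpace (𝓡 4) x) : h.g.inner x u (h.I x u) = 0 := by
  have := h.inner_I_left x u u
  rw [h.g.symm] at this
  linarith

theorem inner_J_self (u : TangentSpace (𝓡 4) x) : h.g.inner x u (h.J x u) = 0 := by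
  have := h.inner_J_left x u u
  rw [h.g.symm] at this
  linarith

theorem inner_K_self (u : TangentSpace (𝓡 4) x) : h.g.inner x u (h.K x u) = 0 := by
  have := h.inner_K_left x u u
  rw [h.g.symm] at this
  linarith

/-- A nonzero tangent vector `u` yields the orthogonal basis `u, Iu, Ju, Ku`, in which every vector
can be expanded. -/
theorem quaternionic_expansion (u a : TangentSpace (𝓡 4) x) :
    h.g.inner x u u • a = h.g.inner x u a • u + h.g.inner x (h.I x u) a • h.I x u +
      h.g.inner x (h.J x u) a • h.J x u + h.g.inner x (h.K x u) a • h.K x u := by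
  rcases eq_or_ne u 0 with rfl | hu
  · simp
  have hn := h.g.pos x u hu
  let e : Fin 4 → TangentSpace (𝓡 4) x := ![u, h.I x u, h.J x u, h.K x u]
  have key : ∀ c : Fin 4 → ℝ, ∀ w, c 0 • u + c 1 • h.I x u + c 2 • h.J x u + c 3 • h.K x u = w →
      h.g.inner x u w = c 0 * h.g.inner x u u ∧ h.g.inner x (h.I x u) w = c 1 * h.g.inner x u u ∧
      h.g.inner x (h.J x u) w = c 2 * h.g.inner x u u ∧
      h.g.inner x (h.K x u) w = c 3 * h.g.inner x u u := by
    rintro c w rfl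
    refine ⟨?_, ?_, ?_, ?_⟩ <;>
      simp [h.inner_I_left, h.inner_J_left, h.inner_K_left, h.I_sq, h.J_sq, h.K_sq, h.I_J, h.J_I,
        h.I_K, h.K_I, h.J_K, h.K_J, h.inner_I_self, h.inner_J_self, h.inner_K_self]
  have hli : LinearIndependent ℝ e := by
    rw [Fintype.linearIndependent_iff]
    intro c hc
    have := key c 0 (by simpa [Fin.sum_univ_four, e] using hc)
    simp only [map_zero, zero_eq_mul, hn.ne', or_false] at this
    intro i
    fin_cases i
    exacts [this.1, this.2.1, this.2.2.1, this.2.2.2]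
  have hspan : Submodule.span ℝ (Set.range e) = ⊤ := by
    have : FiniteDimensional ℝ (TangentSpace (𝓡 4) x) :=
      inferInstanceAs (FiniteDimensional ℝ (EuclideanSpace ℝ (Fin 4)))
    apply hli.span_eq_top_of_card_eq_finrank'
    change _ = Module.finrank ℝ (EuclideanSpace ℝ (Fin 4))
    simp
  have ha : a ∈ Submodule.span ℝ (Set.range e) := by rw [hspan]; trivial
  obtain ⟨c, hc⟩ := (Submodule.mem_span_range_iff_exists_fun ℝ).1 ha
  have hc' : c 0 • u + c 1 • h.I x u + c 2 • h.J x u + c 3 • h.K x u = a := by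
    simpa [Fin.sum_univ_four, e] using hc
  obtain ⟨h0, h1, h2, h3⟩ := key c a hc'
  rw [h0, h1, h2, h3, ← hc']
  module

variable (u a b : TangentSpace (𝓡 4) x)

theorem inner_mul_κI : h.g.inner x u u * h.κI x ![a, b] =
    h.g.inner x u a * h.κI x ![u, b] - h.κI x ![u, a] * h.g.inner x u b +
      (h.κJ x ![u, a] * h.κK x ![u, b] - h.κK x ![u, a] * h.κJ x ![u, b]) := by
  have := congrArg (fun w => h.g.inner x (h.I x w) b) (h.quaternionic_expansion x u a)
  simp only [h.κI_apply, h.κJ_apply, h.κK_apply]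
  simp [h.I_sq, h.I_J, h.I_K] at this
  rw [this]; ring

theorem inner_mul_κJ : h.g.inner x u u * h.κJ x ![a, b] =
    h.g.inner x u a * h.κJ x ![u, b] - h.κJ x ![u, a] * h.g.inner x u b +
      (h.κK x ![u, a] * h.κI x ![u, b] - h.κI x ![u, a] * h.κK x ![u, b]) := by
  have := congrArg (fun w => h.g.inner x (h.J x w) b) (h.quaternionic_expansion x u a)
  simp only [h.κI_apply, h.κJ_apply, h.κK_apply]
  simp [h.J_sq, h.J_I, h.J_K] at this
  rw [this]; ring

theorem κJ_swap : h.κJ x ![b, a] = -h.κJ x ![a, b] := by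
  rw [h.κJ_apply, h.κJ_apply, h.inner_J_left, h.g.symm]

theorem κK_swap : h.κK x ![b, a] = -h.κK x ![a, b] := by
  rw [h.κK_apply, h.κK_apply, h.inner_K_left, h.g.symm]

/-- Three vectors spanning a `κI`-isotropic subspace are linearly dependent, since the subspace has
dimension at most two; `κJ` provides the coefficients of a relation. -/
theorem κJ_relation_of_isotropic (c : TangentSpace (𝓡 4) x) (hab : h.κI x ![a, b] = 0)
    (hac : h.κI x ![a, c] = 0) (hbc : h.κI x ![b, c] = 0) :
    h.κJ x ![b, c] • a - h.κJ x ![a, c] • b + h.κJ x ![a, b] • c = 0 := by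
  rcases eq_or_ne a 0 with rfl | ha
  · simp [h.κJ_apply]
  have hn := h.g.pos x a ha
  have eb := h.quaternionic_expansion x a b
  have ec := h.quaternionic_expansion x a c
  have e1 := h.inner_mul_κJ x a b c
  have e2 := h.inner_mul_κI x a b c
  rw [← h.κI_apply, ← h.κJ_apply, ← h.κK_apply] at eb ec
  rw [hab, hac] at e1 e2
  rw [hbc] at e2
  rw [hab] at eb
  rw [hac] at ec
  refine (smul_eq_zero_iff_right hn.ne').1 ?_
  have e1' : (h.g.inner x a a * h.κJ x ![b, c]) • a =
      (h.g.inner x a b * h.κJ x ![a, c] - h.κJ x ![a, b] * h.g.inner x a c) • a := by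
    rw [e1]; congr 1; ring
  have e2' : (h.κJ x ![a, b] * h.κK x ![a, c]) • h.K x a =
      (h.κK x ![a, b] * h.κJ x ![a, c]) • h.K x a := by
    congr 1; linarith
  have : h.g.inner x a a • (h.κJ x ![b, c] • a - h.κJ x ![a, c] • b + h.κJ x ![a, b] • c) =
      (h.g.inner x a a * h.κJ x ![b, c]) • a - h.κJ x ![a, c] • (h.g.inner x a a • b) +
        h.κJ x ![a, b] • (h.g.inner x a a • c) := by module
  rw [this, eb, ec, e1']
  rw [← sub_eq_zero] at e2'
  rw [← e2']
  module

/-- The pointwise inequality behind the rigidity. Consider three vectors `aᵢ + tᵢ ∂t + sᵢ ∂θ` on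
which `ω` and `Im Ω` vanish. Then `-κK ∧ dθ` has the same sign as `Re Ω` on them, and if it
vanishes while `Re Ω` does not, then so does `dθ` on the three vectors. -/
theorem neg_κK_wedge_dθ_mul_nonneg (a : Fin 3 → TangentSpace (𝓡 4) x) (t s : Fin 3 → ℝ)
    (hω : ∀ i j, h.κI x ![a i, a j] + (t i * s j - t j * s i) = 0) (A B : ℝ)
    (hA : A = h.κJ x ![a 0, a 1] * t 2 - h.κJ x ![a 0, a 2] * t 1 + h.κJ x ![a 1, a 2] * t 0)
    (hB : B = -(h.κK x ![a 0, a 1] * s 2 - h.κK x ![a 0, a 2] * s 1 + h.κK x ![a 1, a 2] * s 0))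
    (hC : h.κK x ![a 0, a 1] * t 2 - h.κK x ![a 0, a 2] * t 1 + h.κK x ![a 1, a 2] * t 0 +
      (h.κJ x ![a 0, a 1] * s 2 - h.κJ x ![a 0, a 2] * s 1 + h.κJ x ![a 1, a 2] * s 0) = 0)
    (hAB : A + B ≠ 0) : 0 ≤ B * (A + B) ∧ (B = 0 → ∀ i, s i = 0) := by
  -- `k = t × s` spans the kernel of `(dt, dθ)` on the span of the three vectors, if nonzero
  obtain ⟨k0, hk0⟩ : ∃ r, r = t 1 * s 2 - t 2 * s 1 := ⟨_, rfl⟩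
  obtain ⟨k1, hk1⟩ : ∃ r, r = t 2 * s 0 - t 0 * s 2 := ⟨_, rfl⟩
  obtain ⟨k2, hk2⟩ : ∃ r, r = t 0 * s 1 - t 1 * s 0 := ⟨_, rfl⟩
  by_cases hk : k0 = 0 ∧ k1 = 0 ∧ k2 = 0
  · obtain ⟨z0, z1, z2⟩ := hk
    have hz : ∀ i j, t i * s j = t j * s i := by
      intro i j
      fin_cases i <;> fin_cases j <;> simp <;> linarith
    -- `dt` and `dθ` are proportional on the three vectors
    obtain ⟨τ, X, Y, hX, hY⟩ : ∃ (τ : Fin 3 → ℝ) (X Y : ℝ),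
        (∀ i, t i = X * τ i) ∧ (∀ i, s i = Y * τ i) := by
      by_cases ht : ∃ i, t i ≠ 0
      · obtain ⟨i, hi⟩ := ht
        refine ⟨t, 1, s i / t i, fun j => by simp, fun j => ?_⟩
        field_simp
        linarith [hz i j]
      · push Not at ht
        exact ⟨s, 0, 1, fun j => by simp [ht j], fun j => by simp⟩
    obtain ⟨qJ, hqJ⟩ : ∃ r, r =
        h.κJ x ![a 0, a 1] * τ 2 - h.κJ x ![a 0, a 2] * τ 1 + h.κJ x ![a 1, a 2] * τ 0 := ⟨_, rfl⟩
    obtain ⟨qK, hqK⟩ : ∃ r, r =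
        h.κK x ![a 0, a 1] * τ 2 - h.κK x ![a 0, a 2] * τ 1 + h.κK x ![a 1, a 2] * τ 0 := ⟨_, rfl⟩
    simp only [hX, hY] at hA hB hC
    have hA' : A = X * qJ := by rw [hA, hqJ]; ring
    have hB' : B = -(Y * qK) := by rw [hB, hqK]; ring
    have hC' : X * qK = -(Y * qJ) := by
      rw [hqJ, hqK]; linarith
    have e : B * (A + B) = Y ^ 2 * (qJ ^ 2 + qK ^ 2) := by
      rw [hA', hB']
      linear_combination (-Y * qJ) * hC'
    refine ⟨by rw [e]; positivity, fun hB0 i => ?_⟩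
    rw [hB0, zero_mul] at e
    rcases mul_eq_zero.1 e.symm with hY0 | hq
    · rw [hY, pow_eq_zero_iff two_ne_zero |>.1 hY0, zero_mul]
    · have : qJ = 0 := by nlinarith [sq_nonneg qJ, sq_nonneg qK]
      exact absurd (by rw [hA', hB0, this]; ring) hAB
  · -- `u` is the vector of the span that is tangent to `M`
    obtain ⟨u, hu⟩ : ∃ r, r = k0 • a 0 + k1 • a 1 + k2 • a 2 := ⟨_, rfl⟩
    obtain ⟨D, hD⟩ : ∃ r, r =
        h.κJ x ![a 0, a 1] * s 2 - h.κJ x ![a 0, a 2] * s 1 + h.κJ x ![a 1, a 2] * s 0 := ⟨_, rfl⟩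
    have κself : ∀ v, h.κJ x ![v, v] = 0 ∧ h.κK x ![v, v] = 0 := by
      intro v
      rw [h.κJ_apply, h.κK_apply, h.g.symm, h.inner_J_self, h.g.symm, h.inner_K_self]
      simp
    have expI : ∀ v, h.κI x ![u, v] = k0 * h.κI x ![a 0, v] + k1 * h.κI x ![a 1, v] +
        k2 * h.κI x ![a 2, v] := by
      intro v; simp [h.κI_apply, hu]
    have expJ : ∀ v, h.κJ x ![u, v] = k0 * h.κJ x ![a 0, v] + k1 * h.κJ x ![a 1, v] +
        k2 * h.κJ x ![a 2, v] := by
      intro v; simp [h.κJ_apply, hu]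
    have expK : ∀ v, h.κK x ![u, v] = k0 * h.κK x ![a 0, v] + k1 * h.κK x ![a 1, v] +
        k2 * h.κK x ![a 2, v] := by
      intro v; simp [h.κK_apply, hu]
    have uI : ∀ i, h.κI x ![u, a i] = 0 := by
      intro i
      rw [expI, eq_neg_of_add_eq_zero_left (hω 0 i), eq_neg_of_add_eq_zero_left (hω 1 i),
        eq_neg_of_add_eq_zero_left (hω 2 i), hk0, hk1, hk2]
      ring
    have uJ : ∀ i, h.κJ x ![u, a i] = D * t i - A * s i := by
      intro i
      rw [expJ, hA, hD, hk0, hk1, hk2]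
      fin_cases i <;> simp only [Fin.zero_eta, Fin.mk_one, Fin.reduceFinMk, κself,
        h.κJ_swap x (a 0) (a 1), h.κJ_swap x (a 0) (a 2), h.κJ_swap x (a 1) (a 2)] <;> ring
    have uK : ∀ i, h.κK x ![u, a i] = -B * t i + D * s i := by
      intro i
      rw [hD, eq_neg_of_add_eq_zero_right hC, expK, hB, hk0, hk1, hk2]
      fin_cases i <;> simp only [Fin.zero_eta, Fin.mk_one, Fin.reduceFinMk, κself,
        h.κK_swap x (a 0) (a 1), h.κK_swap x (a 0) (a 2), h.κK_swap x (a 1) (a 2)] <;> ring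
    have hn : 0 ≤ h.g.inner x u u := by
      rcases eq_or_ne u 0 with hu0 | hu0
      · simp [hu0]
      · exact (h.g.pos x u hu0).le
    have hprod : ∀ i j, (h.g.inner x u u - (A * B - D ^ 2)) * (t i * s j - t j * s i) = 0 := by
      intro i j
      have := h.inner_mul_κI x u (a i) (a j)
      rw [uI, uI, uJ, uJ, uK, uK, eq_neg_of_add_eq_zero_left (hω i j)] at this
      linear_combination -this
    have hk' : ∃ i j, t i * s j - t j * s i ≠ 0 := by
      by_contra! hall
      exact hk ⟨hk0.trans (hall 1 2), hk1.trans (hall 2 0), hk2.trans (hall 0 1)⟩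
    obtain ⟨i, j, hij⟩ := hk'
    have hnAB : h.g.inner x u u = A * B - D ^ 2 := by
      have := (mul_eq_zero.1 (hprod i j)).resolve_right hij
      linarith
    refine ⟨by nlinarith [sq_nonneg B, sq_nonneg D], fun hB0 => ?_⟩
    have hu0 : u = 0 := by
      by_contra hu0
      have := h.g.pos x u hu0
      rw [hnAB, hB0] at this
      nlinarith [sq_nonneg D]
    refine absurd ?_ hAB
    have hJ : ∀ l, D * t l - A * s l = 0 := by
      intro l; rw [← uJ l, hu0]; simp [h.κJ_apply]
    have : A * (t i * s j - t j * s i) = 0 := by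
      linear_combination t j * hJ i - t i * hJ j
    rw [(mul_eq_zero.1 this).resolve_right hij, hB0, add_zero]

end HyperkahlerStructure

/-! ### The forms `κ`, `dt` and `dθ` in coordinates -/

section Box

variable {k : ℕ}

theorem uniqueDiffOn_unitBox : UniqueDiffOn ℝ (Icc (0 : Fin k → ℝ) 1) := by
  refine uniqueDiffOn_convex (convex_Icc 0 1) ⟨fun _ => 1 / 2, ?_⟩
  rw [← pi_univ_Icc, interior_pi_set finite_univ]
  intro i _
  norm_num [interior_Icc]

theorem unitBox_mem_nhds {y : Fin k → ℝ} (hy : y ∈ Set.pi univ fun _ : Fin k => Ioo (0 : ℝ) 1) :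
    Icc (0 : Fin k → ℝ) 1 ∈ 𝓝 y := by
  rw [← pi_univ_Icc]
  exact set_pi_mem_nhds finite_univ fun i hi => Icc_mem_nhds (hy i hi).1 (hy i hi).2

end Box

section PullBack

variable {M : Type*} [TopologicalSpace M] [ChartedSpace (EuclideanSpace ℝ (Fin 4)) M]
  [IsManifold (𝓡 4) ∞ M] {E : Type*} [NormedAddCommGroup E] [NormedSpace ℝ E]

/-- The pull-back of a 2-form under a map into the manifold can be computed in a chart. -/
theorem TwoForm.apply_mfderivWithin (κ : TwoForm M) {F : E → M} {s : Set E} {y : E} (x₀ : M)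
    (hF : MDifferentiableWithinAt 𝓘(ℝ, E) (𝓡 4) F s y) (hs : UniqueDiffWithinAt ℝ s y)
    (hy : F y ∈ (extChartAt (𝓡 4) x₀).source) (u v : E) :
    κ (F y) ![mfderivWithin 𝓘(ℝ, E) (𝓡 4) F s y u, mfderivWithin 𝓘(ℝ, E) (𝓡 4) F s y v] =
      κ.inChart x₀ (extChartAt (𝓡 4) x₀ (F y))
        ![fderivWithin ℝ (extChartAt (𝓡 4) x₀ ∘ F) s y u,
          fderivWithin ℝ (extChartAt (𝓡 4) x₀ ∘ F) s y v] := by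
  have hc : fderivWithin ℝ (extChartAt (𝓡 4) x₀ ∘ F) s y =
      (mfderiv (𝓡 4) 𝓘(ℝ, EuclideanSpace ℝ (Fin 4)) (extChartAt (𝓡 4) x₀) (F y)).comp
        (mfderivWithin 𝓘(ℝ, E) (𝓡 4) F s y) := by
    rw [← mfderivWithin_eq_fderivWithin]
    exact mfderiv_comp_mfderivWithin y (mdifferentiableAt_extChartAt (by simpa using hy)) hF
      hs.uniqueMDiffWithinAt
  have hid := mfderivWithin_extChartAt_symm_comp_mfderiv_extChartAt' hy
  rw [ModelWithCorners.range_eq_univ, mfderivWithin_univ] at hid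
  have key : ∀ (p : M) (A : E →L[ℝ] EuclideanSpace ℝ (Fin 4)), p = F y →
      (∀ w, A w = mfderivWithin 𝓘(ℝ, E) (𝓡 4) F s y w) →
      κ (F y) ![mfderivWithin 𝓘(ℝ, E) (𝓡 4) F s y u, mfderivWithin 𝓘(ℝ, E) (𝓡 4) F s y v] =
        κ p ![A u, A v] := by
    rintro p A rfl hA
    rw [hA, hA]
  rw [hc]
  refine (key _ ((mfderiv 𝓘(ℝ, EuclideanSpace ℝ (Fin 4)) (𝓡 4) (extChartAt (𝓡 4) x₀).symm
    (extChartAt (𝓡 4) x₀ (F y))).comp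
      ((mfderiv (𝓡 4) 𝓘(ℝ, EuclideanSpace ℝ (Fin 4)) (extChartAt (𝓡 4) x₀) (F y)).comp
        (mfderivWithin 𝓘(ℝ, E) (𝓡 4) F s y))) ((extChartAt (𝓡 4) x₀).left_inv hy) ?_).trans ?_
  · intro w
    exact congrArg (fun A => A (mfderivWithin 𝓘(ℝ, E) (𝓡 4) F s y w)) hid
  · refine congrArg (κ ((extChartAt (𝓡 4) x₀).symm (extChartAt (𝓡 4) x₀ (F y))))
      (funext fun i => ?_)
    fin_cases i <;> rfl

end PullBack

section CylinderForms

variable {M : Type*} [TopologicalSpace M] [ChartedSpace (EuclideanSpace ℝ (Fin 4)) M]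

theorem cylProj_eq (z : M × Circle × ℝ) (u : TangentSpace cylModel z) : cylProj z u = u.1 := by
  rw [cylProj, mfderiv_fst]; rfl

theorem cylDt_eq (z : M × Circle × ℝ) (u : TangentSpace cylModel z) : cylDt z u = u.2.2 := by
  have : mfderiv cylModel 𝓘(ℝ, ℝ) (fun w : M × Circle × ℝ => w.2.2) z =
      (mfderiv ((𝓡 1).prod 𝓘(ℝ, ℝ)) 𝓘(ℝ, ℝ) (Prod.snd : Circle × ℝ → ℝ) z.2).comp
        (mfderiv cylModel ((𝓡 1).prod 𝓘(ℝ, ℝ)) (Prod.snd : M × Circle × ℝ → Circle × ℝ) z) :=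
    mfderiv_comp z mdifferentiableAt_snd mdifferentiableAt_snd
  rw [cylDt, this, mfderiv_snd, mfderiv_snd]; rfl

/-- The inclusion of the unit circle in `ℂ`, as a plain function instead of a coercion. -/
def circleCoe (c : Circle) : ℂ := c

theorem contMDiff_circleCoe : ContMDiff (𝓡 1) 𝓘(ℝ, ℂ) ∞ circleCoe :=
  have := finrank_real_complex_fact'
  contMDiff_coe_sphere (E := ℂ) (n := 1)

theorem mdifferentiable_circleCoe : MDifferentiable (𝓡 1) 𝓘(ℝ, ℂ) circleCoe :=
  contMDiff_circleCoe.mdifferentiable (by simp)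

/-- The derivative of the inclusion of the unit circle in `ℂ`. -/
noncomputable def circleDeriv (c : Circle) : EuclideanSpace ℝ (Fin 1) →L[ℝ] ℂ :=
  mfderiv (𝓡 1) 𝓘(ℝ, ℂ) circleCoe c

theorem circleDeriv_injective (c : Circle) : Function.Injective (circleDeriv c) :=
  have := finrank_real_complex_fact'
  injective_mvfderiv_subtypeVal_sphere (E := ℂ) (n := 1) c

theorem re_inv_mul_circleDeriv (c : Circle) (v : EuclideanSpace ℝ (Fin 1)) :
    ((c : ℂ)⁻¹ * circleDeriv c v).re = 0 := by
  have := finrank_real_complex_fact'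
  have hmem : circleDeriv c v ∈ (ℝ ∙ circleCoe c)ᗮ := by
    have hr : (circleDeriv c).range = (ℝ ∙ circleCoe c)ᗮ :=
      range_mvfderiv_subtypeVal (E := ℂ) (n := 1) c
    rw [← hr]
    exact ⟨v, rfl⟩
  rw [Submodule.mem_orthogonal_singleton_iff_inner_right, Complex.inner] at hmem
  rw [← Circle.coe_inv, Circle.coe_inv_eq_conj, mul_comm]
  exact hmem

/-- The derivative of the coordinate `ζ = exp (iθ)` of the cylinder. -/
theorem mfderiv_circleCoord (z : M × Circle × ℝ) (u : TangentSpace cylModel z) :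
    mfderiv cylModel 𝓘(ℝ, ℂ) (fun w : M × Circle × ℝ => (w.2.1 : ℂ)) z u =
      circleDeriv z.2.1 u.2.1 := by
  have h2 : mfderiv cylModel (𝓡 1) (fun w : M × Circle × ℝ => w.2.1) z =
      (mfderiv ((𝓡 1).prod 𝓘(ℝ, ℝ)) (𝓡 1) (Prod.fst : Circle × ℝ → Circle) z.2).comp
        (mfderiv cylModel ((𝓡 1).prod 𝓘(ℝ, ℝ)) (Prod.snd : M × Circle × ℝ → Circle × ℝ) z) :=
    mfderiv_comp z mdifferentiableAt_fst mdifferentiableAt_snd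
  have h1 : mfderiv cylModel 𝓘(ℝ, ℂ) (fun w : M × Circle × ℝ => (w.2.1 : ℂ)) z =
      (mfderiv (𝓡 1) 𝓘(ℝ, ℂ) circleCoe z.2.1).comp
        (mfderiv cylModel (𝓡 1) (fun w : M × Circle × ℝ => w.2.1) z) :=
    mfderiv_comp z (mdifferentiable_circleCoe _)
      (mdifferentiableAt_fst.comp z mdifferentiableAt_snd)
  rw [h1, h2, mfderiv_snd, mfderiv_fst]; rfl

theorem cylDθ_eq (z : M × Circle × ℝ) (u : TangentSpace cylModel z) :
    cylDθ z u = ((z.2.1 : ℂ)⁻¹ * circleDeriv z.2.1 u.2.1).im := by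
  rw [← mfderiv_circleCoord]; rfl

/-- The form `dθ` is injective on the tangent line of the circle. -/
theorem cylDθ_eq_zero_iff (z : M × Circle × ℝ) (u : TangentSpace cylModel z) :
    cylDθ z u = 0 ↔ u.2.1 = 0 := by
  rw [cylDθ_eq]
  constructor
  · intro h
    have h0 : (z.2.1 : ℂ)⁻¹ * circleDeriv z.2.1 u.2.1 = 0 :=
      Complex.ext (re_inv_mul_circleDeriv z.2.1 u.2.1) h
    have h1 := (mul_eq_zero.1 h0).resolve_left (inv_ne_zero (Circle.coe_ne_zero _))
    exact circleDeriv_injective z.2.1 (h1.trans (map_zero _).symm)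
  · intro h
    rw [h, map_zero, mul_zero, Complex.zero_im]

end CylinderForms

/-! ### Closedness of the pull-backs of `dθ` and `κK` to a box -/

theorem two_le_infty : (2 : ℕ∞ω) ≤ ∞ := WithTop.coe_le_coe.2 (le_top : (2 : ℕ∞) ≤ ⊤)

section PulledBackForms

variable {M : Type*} [TopologicalSpace M] [ChartedSpace (EuclideanSpace ℝ (Fin 4)) M]
  {k : ℕ}

/-- The `i`-th partial derivative of a map from the unit box to the cylinder. -/
noncomputable def boxPartial (f : (Fin k → ℝ) → M × Circle × ℝ) (y : Fin k → ℝ) (i : Fin k) :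
    TangentSpace cylModel (f y) :=
  mfderivWithin 𝓘(ℝ, Fin k → ℝ) cylModel f (Icc 0 1) y (Pi.single i (1 : ℝ) : Fin k → ℝ)

/-- The coefficients of the pull-back of `dθ` to the unit box. -/
noncomputable def boxDθ (f : (Fin k → ℝ) → M × Circle × ℝ) (i : Fin k) (y : Fin k → ℝ) : ℝ :=
  cylDθ (f y) (boxPartial f y i)

variable {f : (Fin k → ℝ) → M × Circle × ℝ}

theorem boxDθ_eq {y : Fin k → ℝ} (hy : y ∈ Icc (0 : Fin k → ℝ) 1)
    (hf : MDifferentiableWithinAt 𝓘(ℝ, Fin k → ℝ) cylModel f (Icc 0 1) y) (i : Fin k) :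
    boxDθ f i y = ((circleCoe (f y).2.1)⁻¹ *
      fderivWithin ℝ (fun y => circleCoe (f y).2.1) (Icc 0 1) y (Pi.single i 1)).im := by
  have hu := uniqueDiffOn_unitBox y hy
  have hc : MDifferentiableAt cylModel 𝓘(ℝ, ℂ) (fun w : M × Circle × ℝ => circleCoe w.2.1) (f y) :=
    (mdifferentiable_circleCoe _).comp (f y)
      (mdifferentiableAt_fst.comp (f y) mdifferentiableAt_snd)
  have hD : fderivWithin ℝ (fun y => circleCoe (f y).2.1) (Icc 0 1) y =
      (mfderiv cylModel 𝓘(ℝ, ℂ) (fun w : M × Circle × ℝ => circleCoe w.2.1) (f y)).comp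
        (mfderivWithin 𝓘(ℝ, Fin k → ℝ) cylModel f (Icc 0 1) y) := by
    rw [← mfderivWithin_eq_fderivWithin]
    exact mfderiv_comp_mfderivWithin y hc hf hu.uniqueMDiffWithinAt
  rw [hD]; rfl

theorem contDiffOn_circleCoord (hf : ContMDiffOn 𝓘(ℝ, Fin k → ℝ) cylModel ∞ f (Icc 0 1)) :
    ContDiffOn ℝ ∞ (fun y => circleCoe (f y).2.1) (Icc 0 1) := by
  rw [← contMDiffOn_iff_contDiffOn]
  exact contMDiff_circleCoe.comp_contMDiffOn
    (contMDiff_fst.comp_contMDiffOn (contMDiff_snd.comp_contMDiffOn hf))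

theorem continuousOn_boxDθ (hf : ContMDiffOn 𝓘(ℝ, Fin k → ℝ) cylModel ∞ f (Icc 0 1))
    (i : Fin k) : ContinuousOn (boxDθ f i) (Icc 0 1) := by
  have hζ := contDiffOn_circleCoord hf
  have h1 := hζ.continuousOn_fderivWithin uniqueDiffOn_unitBox (by simp)
  have : ContinuousOn (fun y => ((circleCoe (f y).2.1)⁻¹ *
      fderivWithin ℝ (fun y => circleCoe (f y).2.1) (Icc 0 1) y (Pi.single i 1)).im) (Icc 0 1) :=
    Complex.continuous_im.comp_continuousOn
      ((hζ.continuousOn.inv₀ fun y _ => Circle.coe_ne_zero _).mul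
        (h1.clm_apply continuousOn_const))
  exact this.congr fun y hy => boxDθ_eq hy ((hf y hy).mdifferentiableWithinAt (by simp)) i

/-- In the interior of the box the pull-back of `dθ` is differentiable and closed. -/
theorem boxDθ_differentiableAt_and_closed (hf : ContMDiffOn 𝓘(ℝ, Fin k → ℝ) cylModel ∞ f (Icc 0 1))
    {y₀ : Fin k → ℝ} (hy₀ : y₀ ∈ Set.pi univ fun _ : Fin k => Ioo (0 : ℝ) 1) :
    (∀ i, DifferentiableAt ℝ (boxDθ f i) y₀) ∧
      ∀ i j, fderiv ℝ (boxDθ f i) y₀ (Pi.single j 1) = fderiv ℝ (boxDθ f j) y₀ (Pi.single i 1) := by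
  have hbox := unitBox_mem_nhds hy₀
  have hζ : ContDiffAt ℝ ∞ (fun y => circleCoe (f y).2.1) y₀ :=
    (contDiffOn_circleCoord hf).contDiffAt hbox
  have hζ1 : HasFDerivAt (fun y => circleCoe (f y).2.1) _ y₀ :=
    (hζ.differentiableAt (by simp)).hasFDerivAt
  have hζ2 : HasFDerivAt (fderiv ℝ (fun y => circleCoe (f y).2.1)) _ y₀ :=
    ((hζ.fderiv_right (m := 1) two_le_infty).differentiableAt (by simp)).hasFDerivAt
  have hsymm := hζ.isSymmSndFDerivAt (by simpa using two_le_infty)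
  have hne : circleCoe (f y₀).2.1 ≠ 0 := Circle.coe_ne_zero _
  have hloc : ∀ i, boxDθ f i =ᶠ[𝓝 y₀] fun y => ((circleCoe (f y).2.1)⁻¹ *
      fderiv ℝ (fun y => circleCoe (f y).2.1) y (Pi.single i 1)).im := by
    intro i
    filter_upwards [eventually_eventually_nhds.2 hbox] with y hy
    have hyN : Icc (0 : Fin k → ℝ) 1 ∈ 𝓝 y := hy
    have hy' : y ∈ Icc (0 : Fin k → ℝ) 1 := mem_of_mem_nhds hyN
    rw [boxDθ_eq hy' ((hf y hy').mdifferentiableWithinAt (by simp)), fderivWithin_of_mem_nhds hyN]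
  have hder := fun i => (Complex.imCLM.hasFDerivAt.comp y₀
    (((hasFDerivAt_inv' hne).comp y₀ hζ1).mul'
      (hζ2.clm_apply (hasFDerivAt_const (Pi.single i (1 : ℝ) : Fin k → ℝ) y₀)))).congr_of_eventuallyEq
      (hloc i)
  refine ⟨fun i => (hder i).differentiableAt, fun i j => ?_⟩
  rw [(hder i).fderiv, (hder j).fderiv]
  have := hsymm (Pi.single i 1) (Pi.single j 1)
  simp [this]
  ring

variable [IsManifold (𝓡 4) ∞ M] (h : HyperkahlerStructure M)

/-- The coefficients of the pull-back of `κK` to the unit box. -/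
noncomputable def boxκK (f : (Fin k → ℝ) → M × Circle × ℝ) (i j : Fin k) (y : Fin k → ℝ) : ℝ :=
  h.κK (f y).1 ![cylProj (f y) (boxPartial f y i), cylProj (f y) (boxPartial f y j)]

theorem boxκK_eq {y : Fin k → ℝ} (hy : y ∈ Icc (0 : Fin k → ℝ) 1)
    (hf : MDifferentiableWithinAt 𝓘(ℝ, Fin k → ℝ) cylModel f (Icc 0 1) y) (x₀ : M)
    (hx : (f y).1 ∈ (extChartAt (𝓡 4) x₀).source) (i j : Fin k) :
    boxκK h f i j y = h.κK.inChart x₀ (extChartAt (𝓡 4) x₀ (f y).1)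
      ![fderivWithin ℝ (fun y => extChartAt (𝓡 4) x₀ (f y).1) (Icc 0 1) y (Pi.single i 1),
        fderivWithin ℝ (fun y => extChartAt (𝓡 4) x₀ (f y).1) (Icc 0 1) y (Pi.single j 1)] := by
  have hu := uniqueDiffOn_unitBox y hy
  have hF : MDifferentiableWithinAt 𝓘(ℝ, Fin k → ℝ) (𝓡 4) (fun y => (f y).1) (Icc 0 1) y :=
    mdifferentiableAt_fst.comp_mdifferentiableWithinAt y hf
  have hD : mfderivWithin 𝓘(ℝ, Fin k → ℝ) (𝓡 4) (fun y => (f y).1) (Icc 0 1) y =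
      (mfderiv cylModel (𝓡 4) (Prod.fst : M × Circle × ℝ → M) (f y)).comp
        (mfderivWithin 𝓘(ℝ, Fin k → ℝ) cylModel f (Icc 0 1) y) :=
    mfderiv_comp_mfderivWithin y mdifferentiableAt_fst hf hu.uniqueMDiffWithinAt
  have key := h.κK.apply_mfderivWithin x₀ hF hu hx (Pi.single i 1) (Pi.single j 1)
  rw [hD] at key
  exact key

/-- A smooth map from the unit box to the cylinder reads, near each point, as a smooth map to a
chart of `M`. -/
theorem exists_contDiffOn_chart (hf : ContMDiffOn 𝓘(ℝ, Fin k → ℝ) cylModel ∞ f (Icc 0 1))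
    {y₀ : Fin k → ℝ} (hy₀ : y₀ ∈ Icc (0 : Fin k → ℝ) 1) :
    ∃ U : Set (Fin k → ℝ), IsOpen U ∧ y₀ ∈ U ∧
      (∀ y ∈ Icc 0 1 ∩ U, (f y).1 ∈ (extChartAt (𝓡 4) (f y₀).1).source) ∧
      ContDiffOn ℝ ∞ (fun y => extChartAt (𝓡 4) (f y₀).1 (f y).1) (Icc 0 1 ∩ U) := by
  have hF : ContMDiffOn 𝓘(ℝ, Fin k → ℝ) (𝓡 4) ∞ (fun y => (f y).1) (Icc 0 1) :=
    contMDiff_fst.comp_contMDiffOn hf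
  obtain ⟨U, hU, hUe⟩ := continuousOn_iff'.1 hF.continuousOn _
    (isOpen_extChartAt_source (I := 𝓡 4) (f y₀).1)
  have hsub : ∀ y ∈ Icc 0 1 ∩ U, (f y).1 ∈ (extChartAt (𝓡 4) (f y₀).1).source := by
    rintro y ⟨hy, hyU⟩
    have : y ∈ U ∩ Icc 0 1 := ⟨hyU, hy⟩
    rw [← hUe] at this
    exact this.1
  refine ⟨U, hU, ?_, hsub, ?_⟩
  · have : y₀ ∈ (fun y => (f y).1) ⁻¹' (extChartAt (𝓡 4) (f y₀).1).source ∩ Icc 0 1 :=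
      ⟨mem_extChartAt_source _, hy₀⟩
    rw [hUe] at this
    exact this.1
  · rw [← contMDiffOn_iff_contDiffOn]
    refine (contMDiffOn_extChartAt (I := 𝓡 4) (n := ∞) (x := (f y₀).1)).comp
      (hF.mono inter_subset_left) ?_
    intro y hy
    simpa using hsub y hy

theorem continuousOn_boxκK (hf : ContMDiffOn 𝓘(ℝ, Fin k → ℝ) cylModel ∞ f (Icc 0 1))
    (i j : Fin k) : ContinuousOn (boxκK h f i j) (Icc 0 1) := by
  intro y₀ hy₀
  obtain ⟨U, hU, hyU, hsrc, hw⟩ := exists_contDiffOn_chart hf hy₀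
  have hud : UniqueDiffOn ℝ (Icc (0 : Fin k → ℝ) 1 ∩ U) := uniqueDiffOn_unitBox.inter hU
  have h1 := hw.continuousOn_fderivWithin hud (by simp)
  have h2 : ContinuousOn (fun y => h.κK.inChart (f y₀).1 (extChartAt (𝓡 4) (f y₀).1 (f y).1))
      (Icc 0 1 ∩ U) :=
    (h.smooth_κK (f y₀).1).continuousOn.comp hw.continuousOn
      fun y hy => (extChartAt (𝓡 4) (f y₀).1).map_source (hsrc y hy)
  have h3 : ContinuousOn (fun y => h.κK.inChart (f y₀).1 (extChartAt (𝓡 4) (f y₀).1 (f y).1)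
      ![fderivWithin ℝ (fun y => extChartAt (𝓡 4) (f y₀).1 (f y).1) (Icc 0 1 ∩ U) y
          (Pi.single i 1),
        fderivWithin ℝ (fun y => extChartAt (𝓡 4) (f y₀).1 (f y).1) (Icc 0 1 ∩ U) y
          (Pi.single j 1)]) (Icc 0 1 ∩ U) := by
    refine ContinuousOn.eval h2 (continuousOn_pi.2 fun a => ?_)
    fin_cases a
    · exact h1.clm_apply continuousOn_const
    · exact h1.clm_apply continuousOn_const
  have h4 : ContinuousOn (boxκK h f i j) (Icc 0 1 ∩ U) := by
    refine h3.congr fun y hy => ?_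
    rw [boxκK_eq h hy.1 ((hf y hy.1).mdifferentiableWithinAt (by simp)) (f y₀).1 (hsrc y hy)]
    simp only [fderivWithin_inter (hU.mem_nhds hy.2)]
  exact (h4 y₀ ⟨hy₀, hyU⟩).mono_of_mem_nhdsWithin
    (inter_mem_nhdsWithin _ (hU.mem_nhds hyU))

/-- In the interior of the box the pull-back of `κK` is differentiable and closed. -/
theorem boxκK_differentiableAt_and_closed (hf : ContMDiffOn 𝓘(ℝ, Fin k → ℝ) cylModel ∞ f (Icc 0 1))
    {y₀ : Fin k → ℝ} (hy₀ : y₀ ∈ Set.pi univ fun _ : Fin k => Ioo (0 : ℝ) 1) :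
    (∀ i j, DifferentiableAt ℝ (boxκK h f i j) y₀) ∧
      ∀ i j l, fderiv ℝ (boxκK h f j l) y₀ (Pi.single i 1) -
        fderiv ℝ (boxκK h f i l) y₀ (Pi.single j 1) +
          fderiv ℝ (boxκK h f i j) y₀ (Pi.single l 1) = 0 := by
  have hbox := unitBox_mem_nhds hy₀
  obtain ⟨U, hU, hyU, hsrc, hw⟩ := exists_contDiffOn_chart hf (mem_of_mem_nhds hbox)
  set x₀ := (f y₀).1
  set w := fun y => extChartAt (𝓡 4) x₀ (f y).1 with hwdef
  have hw0 : ContDiffAt ℝ ∞ w y₀ := hw.contDiffAt (Filter.inter_mem hbox (hU.mem_nhds hyU))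
  have hmem : w y₀ ∈ (extChartAt (𝓡 4) x₀).target :=
    (extChartAt (𝓡 4) x₀).map_source (mem_extChartAt_source _)
  have hω : DifferentiableAt ℝ (h.κK.inChart x₀) (w y₀) :=
    ((h.smooth_κK x₀).contDiffAt
      ((isOpen_extChartAt_target x₀).mem_nhds hmem)).differentiableAt (by simp)
  have hd2 : DifferentiableAt ℝ (fderiv ℝ w) y₀ :=
    (hw0.fderiv_right (m := 1) two_le_infty).differentiableAt (by simp)
  have hpull := extDeriv_pullback hω hw0 (by simpa using two_le_infty)
  have hκd : DifferentiableAt ℝ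
      (fun y => (h.κK.inChart x₀ (w y)).compContinuousLinearMap (fderiv ℝ w y)) y₀ :=
    (hω.comp y₀ (hw0.differentiableAt (by simp))).continuousAlternatingMapCompContinuousLinearMap
      hd2
  have hloc : ∀ i j, boxκK h f i j =ᶠ[𝓝 y₀] fun y =>
      (h.κK.inChart x₀ (w y)).compContinuousLinearMap (fderiv ℝ w y)
        ![Pi.single i 1, Pi.single j 1] := by
    intro i j
    filter_upwards [eventually_eventually_nhds.2 hbox, hU.mem_nhds hyU] with y hy hyU
    have hyN : Icc (0 : Fin k → ℝ) 1 ∈ 𝓝 y := hy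
    have hy' : y ∈ Icc (0 : Fin k → ℝ) 1 := mem_of_mem_nhds hyN
    rw [boxκK_eq h hy' ((hf y hy').mdifferentiableWithinAt (by simp)) x₀ (hsrc y ⟨hy', hyU⟩),
      ← hwdef, fderivWithin_of_mem_nhds hyN]
    refine congrArg (h.κK.inChart x₀ (w y)) (funext fun a => ?_)
    fin_cases a <;> rfl
  refine ⟨fun i j => (hκd.continuousAlternatingMap_apply_const _).congr_of_eventuallyEq (hloc i j),
    fun i j l => ?_⟩
  rw [h.closed_κK x₀ _ hmem] at hpull
  have happ := congrArg (fun A => A ![Pi.single i 1, Pi.single j 1, Pi.single l 1]) hpull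
  rw [extDeriv_apply hκd, Fin.sum_univ_three] at happ
  have r0 : (0 : Fin 3).removeNth ![Pi.single i (1 : ℝ), Pi.single j 1, Pi.single l 1] =
      (![Pi.single j 1, Pi.single l 1] : Fin 2 → Fin k → ℝ) := by
    funext a; fin_cases a <;> rfl
  have r1 : (1 : Fin 3).removeNth ![Pi.single i (1 : ℝ), Pi.single j 1, Pi.single l 1] =
      (![Pi.single i 1, Pi.single l 1] : Fin 2 → Fin k → ℝ) := by
    funext a; fin_cases a <;> rfl
  have r2 : (2 : Fin 3).removeNth ![Pi.single i (1 : ℝ), Pi.single j 1, Pi.single l 1] =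
      (![Pi.single i 1, Pi.single j 1] : Fin 2 → Fin k → ℝ) := by
    funext a; fin_cases a <;> rfl
  simp only [r0, r1, r2] at happ
  rw [(hloc j l).fderiv_eq, (hloc i l).fderiv_eq, (hloc i j).fderiv_eq]
  simpa [← sub_eq_add_neg] using happ

end PulledBackForms

/-! ### Stokes' theorem for `κK ∧ dθ` on a cube -/

section Stokes

variable {M : Type*} [TopologicalSpace M] [ChartedSpace (EuclideanSpace ℝ (Fin 4)) M]
  {k : ℕ}

/-- The coefficients of the pull-back to the unit box of the closed 3-form `κK ∧ dθ`. -/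
noncomputable def boxκKDθ [IsManifold (𝓡 4) ∞ M] (h : HyperkahlerStructure M)
    (f : (Fin k → ℝ) → M × Circle × ℝ) (i j l : Fin k) (y : Fin k → ℝ) : ℝ :=
  boxκK h f i j y * boxDθ f l y - boxκK h f i l y * boxDθ f j y + boxκK h f j l y * boxDθ f i y

/-- The partial derivatives of a map restricted to a face of the unit box. -/
theorem boxPartial_insertNth {f : (Fin (k + 1) → ℝ) → M × Circle × ℝ}
    (hf : ContMDiffOn 𝓘(ℝ, Fin (k + 1) → ℝ) cylModel ∞ f (Icc 0 1)) (i : Fin (k + 1)) {e : ℝ}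
    (he : e ∈ Icc (0 : ℝ) 1) {x : Fin k → ℝ} (hx : x ∈ Icc (0 : Fin k → ℝ) 1) (j : Fin k) :
    boxPartial (fun x => f (i.insertNth e x)) x j =
      boxPartial f (i.insertNth e x) (i.succAbove j) := by
  have hmaps : MapsTo (fun x : Fin k → ℝ => (i.insertNth e x : Fin (k + 1) → ℝ)) (Icc 0 1)
      (Icc 0 1) := by
    intro x hx
    refine ⟨fun l => ?_, fun l => ?_⟩
    · induction l using i.succAboveCases with
      | x => simpa using he.1
      | p l => simpa using hx.1 l
    · induction l using i.succAboveCases with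
      | x => simpa using he.2
      | p l => simpa using hx.2 l
  let D : (Fin k → ℝ) →L[ℝ] (Fin (k + 1) → ℝ) := ContinuousLinearMap.pi
    (i.insertNth (α := fun _ => (Fin k → ℝ) →L[ℝ] ℝ) 0 fun l => ContinuousLinearMap.proj l)
  have hD : HasFDerivAt (fun x : Fin k → ℝ => (i.insertNth e x : Fin (k + 1) → ℝ)) D x := by
    rw [hasFDerivAt_pi']
    intro l
    induction l using i.succAboveCases with
    | x => simpa [D, ContinuousLinearMap.proj_pi] using hasFDerivAt_const e x
    | p l => simpa [D, ContinuousLinearMap.proj_pi] using hasFDerivAt_apply (𝕜 := ℝ) l x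
  have hu := uniqueDiffOn_unitBox x hx
  have hcomp : mfderivWithin 𝓘(ℝ, Fin k → ℝ) cylModel (fun x => f (i.insertNth e x)) (Icc 0 1) x =
      (mfderivWithin 𝓘(ℝ, Fin (k + 1) → ℝ) cylModel f (Icc 0 1) (i.insertNth e x)).comp
        (mfderivWithin 𝓘(ℝ, Fin k → ℝ) 𝓘(ℝ, Fin (k + 1) → ℝ)
          (fun x : Fin k → ℝ => (i.insertNth e x : Fin (k + 1) → ℝ)) (Icc 0 1) x) :=
    mfderivWithin_comp x ((hf _ (hmaps hx)).mdifferentiableWithinAt (by simp))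
      hD.hasFDerivWithinAt.hasMFDerivWithinAt.mdifferentiableWithinAt hmaps hu.uniqueMDiffWithinAt
  have hDs : D (Pi.single j 1) = Pi.single (i.succAbove j) 1 := by
    funext l
    induction l using i.succAboveCases with
    | x => simp [D]
    | p l => simp [D, Pi.single_apply]
  rw [boxPartial, hcomp, mfderivWithin_eq_fderivWithin, hD.hasFDerivWithinAt.fderivWithin hu]
  exact congrArg _ hDs

variable [IsManifold (𝓡 4) ∞ M] (h : HyperkahlerStructure M)

theorem continuousOn_boxκKDθ {f : (Fin k → ℝ) → M × Circle × ℝ}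
    (hf : ContMDiffOn 𝓘(ℝ, Fin k → ℝ) cylModel ∞ f (Icc 0 1)) (i j l : Fin k) :
    ContinuousOn (boxκKDθ h f i j l) (Icc 0 1) :=
  (((continuousOn_boxκK h hf i j).mul (continuousOn_boxDθ hf l)).sub
    ((continuousOn_boxκK h hf i l).mul (continuousOn_boxDθ hf j))).add
      ((continuousOn_boxκK h hf j l).mul (continuousOn_boxDθ hf i))

/-- Stokes' theorem for `κK ∧ dθ` and a smooth 4-cube: the integral over the boundary vanishes. -/
theorem sum_integral_boxκKDθ_faces {f : (Fin 4 → ℝ) → M × Circle × ℝ}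
    (hf : ContMDiffOn 𝓘(ℝ, Fin 4 → ℝ) cylModel ∞ f (Icc 0 1)) :
    ∑ i : Fin 4, (-1 : ℝ) ^ (i : ℕ) *
      ((∫ x in Icc (0 : Fin 3 → ℝ) 1,
          boxκKDθ h f (i.succAbove 0) (i.succAbove 1) (i.succAbove 2) (i.insertNth 1 x)) -
        ∫ x in Icc (0 : Fin 3 → ℝ) 1,
          boxκKDθ h f (i.succAbove 0) (i.succAbove 1) (i.succAbove 2) (i.insertNth 0 x)) = 0 := by
  classical
  let F : Fin 4 → (Fin 4 → ℝ) → ℝ := fun i y => (-1 : ℝ) ^ (i : ℕ) *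
    boxκKDθ h f (i.succAbove 0) (i.succAbove 1) (i.succAbove 2) y
  -- the derivative is set to zero outside of the open box, where it plays no role
  let F' : Fin 4 → (Fin 4 → ℝ) → (Fin 4 → ℝ) →L[ℝ] ℝ := fun i y =>
    if y ∈ Set.pi univ (fun _ : Fin 4 => Ioo (0 : ℝ) 1) then fderiv ℝ (F i) y else 0
  have hdη : ∀ y ∈ Set.pi univ (fun _ : Fin 4 => Ioo (0 : ℝ) 1), ∀ i j l,
      HasFDerivAt (boxκKDθ h f i j l)
        ((boxκK h f i j y • fderiv ℝ (boxDθ f l) y + boxDθ f l y • fderiv ℝ (boxκK h f i j) y) -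
        (boxκK h f i l y • fderiv ℝ (boxDθ f j) y + boxDθ f j y • fderiv ℝ (boxκK h f i l) y) +
        (boxκK h f j l y • fderiv ℝ (boxDθ f i) y + boxDθ f i y • fderiv ℝ (boxκK h f j l) y))
        y := by
    intro y hy i j l
    have hκ := (boxκK_differentiableAt_and_closed h hf hy).1
    have hθ := (boxDθ_differentiableAt_and_closed hf hy).1
    exact (((hκ i j).hasFDerivAt.mul (hθ l).hasFDerivAt).sub
      ((hκ i l).hasFDerivAt.mul (hθ j).hasFDerivAt)).add
        ((hκ j l).hasFDerivAt.mul (hθ i).hasFDerivAt)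
  have hFd : ∀ y ∈ Set.pi univ (fun _ : Fin 4 => Ioo (0 : ℝ) 1), ∀ i,
      HasFDerivAt (F i) (F' i y) y := by
    intro y hy i
    simp only [F', if_pos hy]
    exact ((hdη y hy _ _ _).const_mul _).differentiableAt.hasFDerivAt
  have hdiv : ∀ y, ∑ i, F' i y (Pi.single i 1) = 0 := by
    intro y
    by_cases hy : y ∈ Set.pi univ (fun _ : Fin 4 => Ioo (0 : ℝ) 1)
    · have hκ := (boxκK_differentiableAt_and_closed h hf hy).2
      have hθ := (boxDθ_differentiableAt_and_closed hf hy).2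
      have e : ∀ i, F' i y = _ := fun i =>
        (hFd y hy i).unique ((hdη y hy (i.succAbove 0) (i.succAbove 1) (i.succAbove 2)).const_mul
          ((-1 : ℝ) ^ (i : ℕ)))
      simp only [e, Fin.sum_univ_four]
      have s00 : (0 : Fin 4).succAbove 0 = 1 := rfl
      have s01 : (0 : Fin 4).succAbove 1 = 2 := rfl
      have s02 : (0 : Fin 4).succAbove 2 = 3 := rfl
      have s10 : (1 : Fin 4).succAbove 0 = 0 := rfl
      have s11 : (1 : Fin 4).succAbove 1 = 2 := rfl
      have s12 : (1 : Fin 4).succAbove 2 = 3 := rfl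
      have s20 : (2 : Fin 4).succAbove 0 = 0 := rfl
      have s21 : (2 : Fin 4).succAbove 1 = 1 := rfl
      have s22 : (2 : Fin 4).succAbove 2 = 3 := rfl
      have s30 : (3 : Fin 4).succAbove 0 = 0 := rfl
      have s31 : (3 : Fin 4).succAbove 1 = 1 := rfl
      have s32 : (3 : Fin 4).succAbove 2 = 2 := rfl
      have v0 : ((0 : Fin 4) : ℕ) = 0 := rfl
      have v1 : ((1 : Fin 4) : ℕ) = 1 := rfl
      have v2 : ((2 : Fin 4) : ℕ) = 2 := rfl
      have v3 : ((3 : Fin 4) : ℕ) = 3 := rfl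
      simp only [s00, s01, s02, s10, s11, s12, s20, s21, s22, s30, s31, s32, v0, v1, v2, v3,
        smul_apply, add_apply, sub_apply, smul_eq_mul]
      linear_combination boxDθ f 3 y * hκ 0 1 2 - boxDθ f 2 y * hκ 0 1 3 +
        boxDθ f 1 y * hκ 0 2 3 - boxDθ f 0 y * hκ 1 2 3 +
        boxκK h f 1 2 y * hθ 3 0 - boxκK h f 1 3 y * hθ 2 0 + boxκK h f 2 3 y * hθ 1 0 -
        boxκK h f 0 2 y * hθ 3 1 + boxκK h f 0 3 y * hθ 2 1 + boxκK h f 0 1 y * hθ 3 2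
    · simp only [F', if_neg hy, zero_apply, Finset.sum_const_zero]
  have key := integral_divergence_of_hasFDerivAt_off_countable' (0 : Fin 4 → ℝ) 1 zero_le_one
    F F' ∅ countable_empty
    (fun i => (continuousOn_boxκKDθ h hf _ _ _).const_smul ((-1 : ℝ) ^ (i : ℕ)))
    (fun y hy i => hFd y hy.1 i) (by simp [hdiv])
  simp only [hdiv, integral_zero, F, integral_const_mul, ← mul_sub] at key
  exact key.symm

end Stokes

/-! ### Integration of `κK ∧ dθ` over cubical chains -/

section Integration

theorem cubeExtend_coe {Z : Type*} {k : ℕ} (σ : (Fin k → unitInterval) → Z)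
    (x : Fin k → unitInterval) : cubeExtend σ (fun i => (x i : ℝ)) = σ x := by
  simp [cubeExtend]

theorem cubeExtend_mem_range {Z : Type*} {k : ℕ} (σ : (Fin k → unitInterval) → Z)
    (y : Fin k → ℝ) : cubeExtend σ y ∈ Set.range σ := ⟨_, rfl⟩

theorem cubeExtend_cubeFace {Z : Type*} {k : ℕ} (σ : (Fin (k + 1) → unitInterval) → Z)
    (i : Fin (k + 1)) (e : unitInterval) :
    cubeExtend (cubeFace σ i e) = fun x => cubeExtend σ (i.insertNth (e : ℝ) x) := by
  funext x
  refine congrArg σ (funext fun l => ?_)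
  induction l using i.succAboveCases with
  | x => simp
  | p l => simp

variable {M : Type*} [TopologicalSpace M] [ChartedSpace (EuclideanSpace ℝ (Fin 4)) M]

/-- A cube that does not depend on its `i`-th coordinate has no `i`-th partial derivative. -/
theorem boxPartial_eq_zero_of_update {k : ℕ} {σ : (Fin k → unitInterval) → M × Circle × ℝ}
    {i : Fin k} (hσ : ∀ x e, σ (Function.update x i e) = σ x) {y : Fin k → ℝ}
    (hy : y ∈ Icc (0 : Fin k → ℝ) 1) : boxPartial (cubeExtend σ) y i = 0 := by
  classical
  by_cases hd : MDifferentiableWithinAt 𝓘(ℝ, Fin k → ℝ) cylModel (cubeExtend σ) (Icc 0 1) y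
  swap
  · rw [boxPartial, mfderivWithin_zero_of_not_mdifferentiableWithinAt hd]
    rfl
  let P : (Fin k → ℝ) → (Fin k → ℝ) := fun z => Function.update z i (y i)
  have hP : P y = y := Function.update_eq_self i y
  have hmaps : MapsTo P (Icc 0 1) (Icc 0 1) := by
    intro z hz
    refine ⟨fun l => ?_, fun l => ?_⟩
    · rcases eq_or_ne l i with rfl | hl
      · simpa [P] using hy.1 l
      · simpa [P, hl] using hz.1 l
    · rcases eq_or_ne l i with rfl | hl
      · simpa [P] using hy.2 l
      · simpa [P, hl] using hz.2 l
  have hfP : cubeExtend σ ∘ P = cubeExtend σ := by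
    funext z
    simp only [Function.comp_apply, cubeExtend, P]
    rw [← hσ (fun l => projIcc 0 1 zero_le_one (z l)) (projIcc 0 1 zero_le_one (y i))]
    refine congrArg σ (funext fun l => ?_)
    rcases eq_or_ne l i with rfl | hl
    · simp
    · simp [hl]
  let D : (Fin k → ℝ) →L[ℝ] (Fin k → ℝ) := ContinuousLinearMap.pi
    (Function.update (fun l => ContinuousLinearMap.proj l) i 0)
  have hD : HasFDerivAt P D y := by
    rw [hasFDerivAt_pi']
    intro l
    rcases eq_or_ne l i with rfl | hl
    · simpa [D, P, ContinuousLinearMap.proj_pi] using hasFDerivAt_const (y l) y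
    · simpa [D, P, ContinuousLinearMap.proj_pi, hl] using hasFDerivAt_apply (𝕜 := ℝ) l y
  have hDi : D (Pi.single i 1) = 0 := by
    funext l
    rcases eq_or_ne l i with rfl | hl
    · simp [D]
    · simp [D, hl]
  have hu := uniqueDiffOn_unitBox y hy
  have hcomp : mfderivWithin 𝓘(ℝ, Fin k → ℝ) cylModel (cubeExtend σ ∘ P) (Icc 0 1) y =
      (mfderivWithin 𝓘(ℝ, Fin k → ℝ) cylModel (cubeExtend σ) (Icc 0 1) y).comp
        (mfderivWithin 𝓘(ℝ, Fin k → ℝ) 𝓘(ℝ, Fin k → ℝ) P (Icc 0 1) y) :=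
    mfderivWithin_comp_of_eq hd
      hD.hasFDerivWithinAt.hasMFDerivWithinAt.mdifferentiableWithinAt hmaps
      hu.uniqueMDiffWithinAt hP
  rw [mfderivWithin_eq_fderivWithin, hD.hasFDerivWithinAt.fderivWithin hu, hfP] at hcomp
  rw [boxPartial, hcomp]
  exact (congrArg (mfderivWithin 𝓘(ℝ, Fin k → ℝ) cylModel (cubeExtend σ) (Icc 0 1) y) hDi).trans
    (map_zero _)

variable [IsManifold (𝓡 4) ∞ M] (h : HyperkahlerStructure M)

/-- The integral of `κK ∧ dθ` over a 3-cube. -/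
noncomputable def cubeIntegral (σ : (Fin 3 → unitInterval) → M × Circle × ℝ) : ℝ :=
  ∫ y in Icc (0 : Fin 3 → ℝ) 1, boxκKDθ h (cubeExtend σ) 0 1 2 y

/-- The integral of `κK ∧ dθ` over a chain. -/
noncomputable def chainIntegral : CubeChain (M × Circle × ℝ) 3 →+ ℝ :=
  Finsupp.liftAddHom fun σ => (AddMonoidHom.mulRight (cubeIntegral h σ)).comp (Int.castAddHom ℝ)

theorem chainIntegral_single (σ : (Fin 3 → unitInterval) → M × Circle × ℝ) (m : ℤ) :
    chainIntegral h (Finsupp.single σ m) = m * cubeIntegral h σ := by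
  simp [chainIntegral]

theorem chainIntegral_eq_sum (c : CubeChain (M × Circle × ℝ) 3) :
    chainIntegral h c = ∑ σ ∈ c.support, (c σ : ℝ) * cubeIntegral h σ := by
  simp [chainIntegral, Finsupp.sum]

/-- The form `κK ∧ dθ` vanishes on cubes in a slice `θ = p`. -/
theorem cubeIntegral_eq_zero_of_circle {σ : (Fin 3 → unitInterval) → M × Circle × ℝ}
    (hσ : IsSmoothCube cylModel σ) {p : Circle} (hp : ∀ x, (σ x).2.1 = p) :
    cubeIntegral h σ = 0 := by
  have hθ : ∀ i, ∀ y ∈ Icc (0 : Fin 3 → ℝ) 1, boxDθ (cubeExtend σ) i y = 0 := by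
    intro i y hy
    rw [boxDθ_eq hy ((hσ y hy).mdifferentiableWithinAt (by simp))]
    have : (fun y => circleCoe (cubeExtend σ y).2.1) = fun _ => circleCoe p := by
      funext y; exact congrArg circleCoe (hp _)
    rw [this, fderivWithin_const_apply]
    simp
  refine (setIntegral_congr_fun measurableSet_Icc fun y hy => ?_).trans (integral_zero _ _)
  simp [boxκKDθ, hθ _ y hy]

/-- The form `κK ∧ dθ` vanishes on degenerate cubes. -/
theorem cubeIntegral_eq_zero_of_update {σ : (Fin 3 → unitInterval) → M × Circle × ℝ} {i : Fin 3}
    (hσ : ∀ x e, σ (Function.update x i e) = σ x) : cubeIntegral h σ = 0 := by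
  refine (setIntegral_congr_fun measurableSet_Icc fun y hy => ?_).trans (integral_zero _ _)
  have h0 := boxPartial_eq_zero_of_update hσ hy
  have hp : cylProj (cubeExtend σ y) (boxPartial (cubeExtend σ) y i) = 0 := by
    rw [h0]; exact map_zero _
  have hθ : boxDθ (cubeExtend σ) i y = 0 := by
    rw [boxDθ, cylDθ_eq_zero_iff, h0]; rfl
  have hl : ∀ j, boxκK h (cubeExtend σ) i j y = 0 := by
    intro j; rw [boxκK, hp, h.κK_apply]; simp
  have hr : ∀ j, boxκK h (cubeExtend σ) j i y = 0 := by
    intro j; rw [boxκK, hp, h.κK_apply]; simp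
  fin_cases i <;> simp_all [boxκKDθ]

/-- The integral of `κK ∧ dθ` over a boundary vanishes. -/
theorem chainIntegral_boundary {W : CubeChain (M × Circle × ℝ) 4} {X : Set (M × Circle × ℝ)}
    (hW : W ∈ smoothChains cylModel X 4) : chainIntegral h (cubeBoundary W) = 0 := by
  let B : CubeChain (M × Circle × ℝ) 4 →+ ℝ := Finsupp.liftAddHom fun σ =>
    (AddMonoidHom.mulRight (∑ i : Fin 4, (-1 : ℝ) ^ (i : ℕ) *
      (cubeIntegral h (cubeFace σ i 1) - cubeIntegral h (cubeFace σ i 0)))).comp (Int.castAddHom ℝ)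
  have hB : ∀ W, chainIntegral h (cubeBoundary W) = B W := by
    intro W
    rw [cubeBoundary, map_finsuppSum]
    simp only [B, Finsupp.liftAddHom_apply, map_sum, map_zsmul, map_sub, chainIntegral_single]
    refine Finset.sum_congr rfl fun σ _ => ?_
    simp only [AddMonoidHom.coe_comp, Function.comp_apply, AddMonoidHom.coe_mulRight,
      Int.coe_castAddHom, Finset.mul_sum, zsmul_eq_mul]
    refine Finset.sum_congr rfl fun i _ => ?_
    push_cast
    ring
  rw [hB]
  refine (AddSubgroup.closure_le B.ker).2 ?_ hW
  rintro _ ⟨σ, hσ, -, rfl⟩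
  have hface : ∀ (i : Fin 4) (e : unitInterval), cubeIntegral h (cubeFace σ i e) =
      ∫ x in Icc (0 : Fin 3 → ℝ) 1, boxκKDθ h (cubeExtend σ) (i.succAbove 0) (i.succAbove 1)
        (i.succAbove 2) (i.insertNth (e : ℝ) x) := by
    intro i e
    refine setIntegral_congr_fun measurableSet_Icc fun x hx => ?_
    have hp := fun j => boxPartial_insertNth hσ i e.2 hx j
    rw [cubeExtend_cubeFace]
    simp only [boxκKDθ, boxκK, boxDθ, hp]
  have key := sum_integral_boxκKDθ_faces h hσ
  have h1 := fun i => hface i 1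
  have h0 := fun i => hface i 0
  simp only [Set.Icc.coe_one, Set.Icc.coe_zero] at h1 h0
  simp only [← h1, ← h0] at key
  simp [B, key]

/-- The integral of `κK ∧ dθ` is the same over relatively homologous chains, and vanishes over
chains in a slice `θ = p`. -/
theorem chainIntegral_eq_zero {X A S : Set (M × Circle × ℝ)} {p : Circle}
    (hA : ∀ z ∈ A, z.2.1 = p) (hS : ∀ z ∈ S, z.2.1 = p) {c c' : CubeChain (M × Circle × ℝ) 3}
    (hc : ∀ σ ∈ c.support, IsSmoothCube cylModel σ ∧ Set.range σ ⊆ S)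
    {W : CubeChain (M × Circle × ℝ) 4} (hW : W ∈ smoothChains cylModel X 4)
    (hcW : c' - c - cubeBoundary W ∈ smoothChains cylModel A 3 ⊔
      degenerateChains (M × Circle × ℝ) 3) : chainIntegral h c' = 0 := by
  have hker : smoothChains cylModel A 3 ⊔ degenerateChains (M × Circle × ℝ) 3 ≤
      (chainIntegral h).ker := by
    refine sup_le ((AddSubgroup.closure_le _).2 ?_) ((AddSubgroup.closure_le _).2 ?_)
    · rintro _ ⟨σ, hσ, hσA, rfl⟩
      have := cubeIntegral_eq_zero_of_circle h hσ fun x => hA _ (hσA ⟨x, rfl⟩)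
      simp [chainIntegral_single, this]
    · rintro _ ⟨σ, ⟨i, hi⟩, rfl⟩
      simp [chainIntegral_single, cubeIntegral_eq_zero_of_update h hi]
  have h0 : chainIntegral h c = 0 := by
    rw [chainIntegral_eq_sum]
    refine Finset.sum_eq_zero fun σ hσ => ?_
    rw [cubeIntegral_eq_zero_of_circle h (hc σ hσ).1 fun x => hS _ ((hc σ hσ).2 ⟨x, rfl⟩), mul_zero]
  have := AddMonoidHom.mem_ker.1 (hker hcW)
  rwa [map_sub, map_sub, h0, chainIntegral_boundary h hW, sub_zero, sub_zero] at this

end Integration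

/-! ### Tangent spaces of subsets -/

section TangentSpaces

variable {E : Type*} [NormedAddCommGroup E] [NormedSpace ℝ E]
  {H : Type*} [TopologicalSpace H] {I : ModelWithCorners ℝ E H}
  {Z : Type*} [TopologicalSpace Z] [ChartedSpace H Z]
  {F : Type*} [NormedAddCommGroup F] [NormedSpace ℝ F]

/-- The derivative of a map into a subset of a manifold takes values in its tangent space. -/
theorem mfderivWithin_mem_tangentSpaceOf [IsManifold I 1 Z] {f : F → Z} {s : Set F} {y : F}
    {S : Set Z} (hf : MDifferentiableWithinAt 𝓘(ℝ, F) I f s y) (hs : UniqueDiffWithinAt ℝ s y)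
    (hspan : Submodule.span ℝ (tangentConeAt ℝ s y) = ⊤) (hS : MapsTo f s S) (v : F) :
    (mfderivWithin 𝓘(ℝ, F) I f s y v : E) ∈ tangentSpaceOf I S (f y) := by
  let w : F → E := fun y' => extChartAt I (f y) (f y')
  have hmd : MDifferentiableWithinAt 𝓘(ℝ, F) 𝓘(ℝ, E) w s y :=
    (mdifferentiableAt_extChartAt (mem_chart_source H (f y))).comp_mdifferentiableWithinAt y hf
  have hfd : fderivWithin ℝ w s y =
      (mfderiv I 𝓘(ℝ, E) (extChartAt I (f y)) (f y)).comp (mfderivWithin 𝓘(ℝ, F) I f s y) := by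
    rw [← mfderivWithin_eq_fderivWithin]
    exact mfderiv_comp_mfderivWithin y (mdifferentiableAt_extChartAt (mem_chart_source H (f y))) hf
      hs.uniqueMDiffWithinAt
  rw [mfderiv_extChartAt_self] at hfd
  have hw : HasFDerivWithinAt w (fderivWithin ℝ w s y) s y :=
    hmd.differentiableWithinAt.hasFDerivWithinAt
  have hU : f ⁻¹' (extChartAt I (f y)).source ∈ 𝓝[s] y :=
    hf.continuousWithinAt (extChartAt_source_mem_nhds (f y))
  have hcone : tangentConeAt ℝ s y ⊆
      tangentConeAt ℝ (s ∩ f ⁻¹' (extChartAt I (f y)).source) y :=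
    tangentConeAt_mono_nhds (nhdsWithin_le_iff.2 (Filter.inter_mem self_mem_nhdsWithin hU))
  have hsub : w '' (s ∩ f ⁻¹' (extChartAt I (f y)).source) ⊆
      extChartAt I (f y) '' (S ∩ (extChartAt I (f y)).source) := by
    rintro _ ⟨y', ⟨hy', hy''⟩, rfl⟩
    exact ⟨f y', ⟨hS hy', hy''⟩, rfl⟩
  have hle : Submodule.span ℝ (tangentConeAt ℝ s y) ≤
      Submodule.comap (fderivWithin ℝ w s y).toLinearMap (Submodule.span ℝ
        (tangentConeAt ℝ (extChartAt I (f y) '' (S ∩ (extChartAt I (f y)).source)) (w y))) := by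
    refine Submodule.span_le.2 fun u hu => Submodule.subset_span ?_
    exact tangentConeAt_mono hsub ((hw.mono inter_subset_left).mapsTo_tangent_cone (hcone hu))
  rw [hspan] at hle
  have := hle (Submodule.mem_top (x := v))
  rw [Submodule.mem_comap] at this
  change fderivWithin ℝ w s y v ∈ _ at this
  rw [hfd] at this
  exact this

/-- A differentiable map, read in the preferred chart, that sends a subset of a manifold to a
closed subspace has a derivative that sends the tangent space to this subspace. -/
theorem fderiv_mem_of_mem_tangentSpaceOf {S : Set Z} {z : Z} {ψ : E → F} {ψ' : E →L[ℝ] F}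
    (hψ : HasFDerivAt ψ ψ' (extChartAt I z z)) {V : Submodule ℝ F} (hV : IsClosed (V : Set F))
    {U : Set E} (hU : U ∈ 𝓝 (extChartAt I z z))
    (hS : ∀ w ∈ S ∩ (extChartAt I z).source, extChartAt I z w ∈ U → ψ (extChartAt I z w) ∈ V)
    (hz : z ∈ S) {u : E} (hu : u ∈ tangentSpaceOf I S z) : ψ' u ∈ V := by
  have hle : tangentSpaceOf I S z ≤ V.comap ψ'.toLinearMap := by
    refine Submodule.span_le.2 fun u hu => ?_
    rw [← tangentConeAt_inter_nhds hU] at hu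
    have hc := hψ.hasFDerivWithinAt.mapsTo_tangent_cone hu
    have hsub : ψ '' (extChartAt I z '' (S ∩ (extChartAt I z).source) ∩ U) ⊆ V := by
      rintro _ ⟨_, ⟨⟨w, hw, rfl⟩, hwU⟩, rfl⟩
      exact hS w hw hwU
    obtain ⟨c, d, -, hd, hcd⟩ := mem_tangentConeAt_iff_exists_seq.1 (tangentConeAt_mono hsub hc)
    refine hV.mem_of_tendsto hcd (hd.mono fun n hn => V.smul_mem _ ?_)
    have h0 : ψ (extChartAt I z z) ∈ V :=
      hS z ⟨hz, mem_extChartAt_source z⟩ (mem_of_mem_nhds hU)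
    simpa using V.sub_mem hn h0
  exact hle hu

end TangentSpaces

section CubeTangents

variable {M : Type*} [TopologicalSpace M] [ChartedSpace (EuclideanSpace ℝ (Fin 4)) M]
  [IsManifold (𝓡 4) ∞ M]

theorem cubePartial_mem_tangentSpaceOf {k : ℕ} {σ : (Fin k → unitInterval) → M × Circle × ℝ}
    (hσ : IsSmoothCube cylModel σ) {S : Set (M × Circle × ℝ)} (hS : Set.range σ ⊆ S)
    {y : Fin k → ℝ} (hy : y ∈ Icc (0 : Fin k → ℝ) 1) (i : Fin k) :
    cubePartial cylModel σ y i ∈ tangentSpaceOf cylModel S (cubeExtend σ y) := by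
  have hint : (interior (Icc (0 : Fin k → ℝ) 1)).Nonempty := by
    refine ⟨fun _ => 1 / 2, mem_interior_iff_mem_nhds.2 (unitBox_mem_nhds fun i _ => ?_)⟩
    norm_num
  exact mfderivWithin_mem_tangentSpaceOf ((hσ y hy).mdifferentiableWithinAt (by simp))
    (uniqueDiffOn_unitBox y hy)
    ((convex_Icc 0 1).span_tangentConeAt hint (subset_closure hy))
    (fun y' _ => hS (cubeExtend_mem_range σ y')) _

end CubeTangents

/-! ### Special Lagrangian tangent spaces with `dθ = 0` -/

section TangentPlanes

variable {M : Type*} [TopologicalSpace M] [ChartedSpace (EuclideanSpace ℝ (Fin 4)) M]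

/-- The vector field `∂t` on the cylinder, in terms of the model space. -/
def cylVertical : EuclideanSpace ℝ (Fin 4) × EuclideanSpace ℝ (Fin 1) × ℝ := (0, 0, 1)

variable [IsManifold (𝓡 4) ∞ M] (h : HyperkahlerStructure M) {z : M × Circle × ℝ}
  {u : Fin 3 → TangentSpace cylModel z}

theorem re_cylVolumeForm : (cylVolumeForm h z u).re =
    h.κJ z.1 ![cylProj z (u 0), cylProj z (u 1)] * cylDt z (u 2) -
      h.κJ z.1 ![cylProj z (u 0), cylProj z (u 2)] * cylDt z (u 1) +
      h.κJ z.1 ![cylProj z (u 1), cylProj z (u 2)] * cylDt z (u 0) -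
    (h.κK z.1 ![cylProj z (u 0), cylProj z (u 1)] * cylDθ z (u 2) -
      h.κK z.1 ![cylProj z (u 0), cylProj z (u 2)] * cylDθ z (u 1) +
      h.κK z.1 ![cylProj z (u 1), cylProj z (u 2)] * cylDθ z (u 0)) := by
  simp [cylVolumeForm]
  ring

theorem im_cylVolumeForm : (cylVolumeForm h z u).im =
    h.κK z.1 ![cylProj z (u 0), cylProj z (u 1)] * cylDt z (u 2) -
      h.κK z.1 ![cylProj z (u 0), cylProj z (u 2)] * cylDt z (u 1) +
      h.κK z.1 ![cylProj z (u 1), cylProj z (u 2)] * cylDt z (u 0) +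
    (h.κJ z.1 ![cylProj z (u 0), cylProj z (u 1)] * cylDθ z (u 2) -
      h.κJ z.1 ![cylProj z (u 0), cylProj z (u 2)] * cylDθ z (u 1) +
      h.κJ z.1 ![cylProj z (u 1), cylProj z (u 2)] * cylDθ z (u 0)) := by
  simp [cylVolumeForm]
  ring

/-- If `ω` and `dθ` vanish on three vectors and `Re Ω` does not, then the vectors are linearly
independent and their span contains `∂t`. -/
theorem linearIndependent_and_exists_sum_eq_cylVertical
    (hω : ∀ i j, cylKahlerForm h z (u i) (u j) = 0) (hre : (cylVolumeForm h z u).re ≠ 0)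
    (hθ : ∀ i, cylDθ z (u i) = 0) :
    (∀ c : Fin 3 → ℝ, ∑ i, c i • u i = 0 → ∀ i, c i = 0) ∧
      ∃ c : Fin 3 → ℝ, ∑ i, c i • u i = cylVertical := by
  rw [re_cylVolumeForm] at hre
  simp only [hθ, mul_zero, sub_zero, add_zero] at hre
  simp only [cylKahlerForm, hθ, mul_zero, sub_zero, add_zero] at hω
  have hproj : ∀ c : Fin 3 → ℝ, cylProj z (∑ i, c i • u i) =
      c 0 • cylProj z (u 0) + c 1 • cylProj z (u 1) + c 2 • cylProj z (u 2) := by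
    intro c
    rw [Fin.sum_univ_three]
    simp only [cylProj, map_add, map_smul]
  have hdt : ∀ c : Fin 3 → ℝ, cylDt z (∑ i, c i • u i) =
      c 0 * cylDt z (u 0) + c 1 * cylDt z (u 1) + c 2 * cylDt z (u 2) := by
    intro c
    rw [Fin.sum_univ_three]
    simp only [cylDt_eq]
    rfl
  generalize ha : (fun i => cylProj z (u i)) = a at *
  have ha' : ∀ i, cylProj z (u i) = a i := fun i => congrFun ha i
  generalize ht : (fun i => cylDt z (u i)) = t at *
  have ht' : ∀ i, cylDt z (u i) = t i := fun i => congrFun ht i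
  simp only [ha', ht'] at hω hre hproj hdt
  obtain ⟨A, hA⟩ : ∃ A, A = h.κJ z.1 ![a 0, a 1] * t 2 - h.κJ z.1 ![a 0, a 2] * t 1 +
    h.κJ z.1 ![a 1, a 2] * t 0 := ⟨_, rfl⟩
  rw [← hA] at hre
  constructor
  · intro c hc
    have h1 := hproj c
    have h2 := hdt c
    rw [hc, show cylProj z (0 : TangentSpace cylModel z) = 0 from map_zero _] at h1
    rw [hc, show cylDt z (0 : TangentSpace cylModel z) = 0 from map_zero _] at h2
    have h3 : ∀ j, c 0 * h.κJ z.1 ![a 0, a j] + c 1 * h.κJ z.1 ![a 1, a j] +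
        c 2 * h.κJ z.1 ![a 2, a j] = 0 := by
      intro j
      have : h.κJ z.1 ![0, a j] = 0 := by simp [h.κJ_apply]
      rw [h1] at this
      rw [← this]
      simp [h.κJ_apply]
    have hself : ∀ v, h.κJ z.1 ![v, v] = 0 := by
      intro v
      rw [h.κJ_apply, h.g.symm, h.inner_J_self]
    have e0 := h3 0
    have e1 := h3 1
    have e2 := h3 2
    rw [hself, h.κJ_swap z.1 (a 0) (a 1), h.κJ_swap z.1 (a 0) (a 2)] at e0
    rw [hself, h.κJ_swap z.1 (a 1) (a 2)] at e1
    rw [hself] at e2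
    have c0 : c 0 * A = 0 := by
      rw [hA]
      linear_combination t 2 * e1 - t 1 * e2 - h.κJ z.1 ![a 1, a 2] * h2
    have c1 : c 1 * A = 0 := by
      rw [hA]
      linear_combination t 0 * e2 - t 2 * e0 + h.κJ z.1 ![a 0, a 2] * h2
    have c2 : c 2 * A = 0 := by
      rw [hA]
      linear_combination t 1 * e0 - t 0 * e1 - h.κJ z.1 ![a 0, a 1] * h2
    intro i
    fin_cases i
    exacts [(mul_eq_zero.1 c0).resolve_right hre, (mul_eq_zero.1 c1).resolve_right hre,
      (mul_eq_zero.1 c2).resolve_right hre]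
  · have hrel := h.κJ_relation_of_isotropic z.1 (a 0) (a 1) (a 2) (hω 0 1) (hω 0 2) (hω 1 2)
    let c : Fin 3 → ℝ := ![A⁻¹ * h.κJ z.1 ![a 1, a 2], -(A⁻¹ * h.κJ z.1 ![a 0, a 2]),
      A⁻¹ * h.κJ z.1 ![a 0, a 1]]
    refine ⟨c, ?_⟩
    have h1 : (∑ i, c i • u i).1 = (0 : EuclideanSpace ℝ (Fin 4)) := by
      rw [← cylProj_eq, hproj]
      have : c 0 • a 0 + c 1 • a 1 + c 2 • a 2 = A⁻¹ • (h.κJ z.1 ![a 1, a 2] • a 0 -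
          h.κJ z.1 ![a 0, a 2] • a 1 + h.κJ z.1 ![a 0, a 1] • a 2) := by
        simp only [c, Matrix.cons_val_zero, Matrix.cons_val_one, Matrix.cons_val]
        module
      rw [this, hrel, smul_zero]
      rfl
    have h2 : (∑ i, c i • u i).2.1 = (0 : EuclideanSpace ℝ (Fin 1)) := by
      have hu : ∀ i, (u i).2.1 = (0 : EuclideanSpace ℝ (Fin 1)) := fun i =>
        (cylDθ_eq_zero_iff z (u i)).1 (hθ i)
      rw [Fin.sum_univ_three]
      change c 0 • (u 0).2.1 + c 1 • (u 1).2.1 + c 2 • (u 2).2.1 = (0 : EuclideanSpace ℝ (Fin 1))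
      simp [hu]
    have h3 : (∑ i, c i • u i).2.2 = (1 : ℝ) := by
      rw [← cylDt_eq, hdt]
      simp only [c, Matrix.cons_val_zero, Matrix.cons_val_one, Matrix.cons_val]
      field_simp
      rw [hA]; ring
    exact Prod.ext h1 (Prod.ext h2 h3)

end TangentPlanes

/-! ### The calibration argument -/

section Calibration

variable {M : Type*} [TopologicalSpace M] [ChartedSpace (EuclideanSpace ℝ (Fin 4)) M]
  [IsManifold (𝓡 4) ∞ M] (h : HyperkahlerStructure M) {S : Set (M × Circle × ℝ)}

/-- On the cubes of a special Lagrangian, `-κK ∧ dθ` is nonnegative with respect to the orientation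
by `Re Ω`, and vanishes only where `dθ` does. -/
theorem boxκKDθ_nonpos_of_specialLagrangian (hS : IsSpecialLagrangianThreefold h S)
    {σ : (Fin 3 → unitInterval) → M × Circle × ℝ} (hσ : IsSmoothCube cylModel σ)
    (hσS : Set.range σ ⊆ S) {m : ℝ} {y : Fin 3 → ℝ} (hy : y ∈ Icc (0 : Fin 3 → ℝ) 1)
    (hm : 0 < m * cylReΩ h (cubeExtend σ y) (cubePartial cylModel σ y)) :
    m * boxκKDθ h (cubeExtend σ) 0 1 2 y ≤ 0 ∧ (m * boxκKDθ h (cubeExtend σ) 0 1 2 y = 0 →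
      ∀ i, cylDθ (cubeExtend σ y) (cubePartial cylModel σ y i) = 0) := by
  have hmem := cubePartial_mem_tangentSpaceOf hσ hσS hy
  have hz : cubeExtend σ y ∈ S := hσS (cubeExtend_mem_range σ y)
  have hω : ∀ i j, cylKahlerForm h (cubeExtend σ y) (cubePartial cylModel σ y i)
      (cubePartial cylModel σ y j) = 0 := fun i j =>
    (hS.2 _ hz ![cubePartial cylModel σ y i, cubePartial cylModel σ y j,
      cubePartial cylModel σ y j] (by intro l; fin_cases l <;> exact hmem _)).1
  have him := (hS.2 _ hz (cubePartial cylModel σ y) hmem).2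
  have hre : (cylVolumeForm h (cubeExtend σ y) (cubePartial cylModel σ y)).re ≠ 0 := by
    intro h0
    rw [cylReΩ, h0, mul_zero] at hm
    exact hm.false
  rw [cylReΩ] at hm
  rw [im_cylVolumeForm] at him
  rw [re_cylVolumeForm, sub_eq_add_neg] at hre hm
  have key := h.neg_κK_wedge_dθ_mul_nonneg (cubeExtend σ y).1
    (fun i => cylProj (cubeExtend σ y) (cubePartial cylModel σ y i))
    (fun i => cylDt (cubeExtend σ y) (cubePartial cylModel σ y i))
    (fun i => cylDθ (cubeExtend σ y) (cubePartial cylModel σ y i)) hω _ _ rfl rfl him hre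
  have hη : boxκKDθ h (cubeExtend σ) 0 1 2 y =
      h.κK (cubeExtend σ y).1 ![cylProj _ (cubePartial cylModel σ y 0),
          cylProj _ (cubePartial cylModel σ y 1)] *
        cylDθ _ (cubePartial cylModel σ y 2) -
      h.κK (cubeExtend σ y).1 ![cylProj _ (cubePartial cylModel σ y 0),
          cylProj _ (cubePartial cylModel σ y 2)] *
        cylDθ _ (cubePartial cylModel σ y 1) +
      h.κK (cubeExtend σ y).1 ![cylProj _ (cubePartial cylModel σ y 1),
          cylProj _ (cubePartial cylModel σ y 2)] *
        cylDθ _ (cubePartial cylModel σ y 0) := rfl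
  rw [← hη] at key hm
  obtain ⟨h1, h2⟩ := key
  generalize boxκKDθ h (cubeExtend σ) 0 1 2 y = η at *
  rcases lt_trichotomy m 0 with hm0 | rfl | hm0
  · refine ⟨?_, fun h0 => h2 ?_⟩
    · have := neg_of_mul_pos_right hm hm0.le
      nlinarith
    · have := (mul_eq_zero.1 h0).resolve_left hm0.ne
      simp [this]
  · simp at hm
  · refine ⟨?_, fun h0 => h2 ?_⟩
    · have := pos_of_mul_pos_right hm hm0.le
      nlinarith
    · have := (mul_eq_zero.1 h0).resolve_left hm0.ne'
      simp [this]

/-- If the integral of `κK ∧ dθ` over a special Lagrangian vanishes, then so does `dθ` on all of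
its tangent spaces, and these contain `∂t`. -/
theorem exists_tangent_basis_of_chainIntegral_eq_zero (hS : IsSpecialLagrangianThreefold h S)
    {c : CubeChain (M × Circle × ℝ) 3} (hc : IsFundamentalChain cylModel 2 (cylReΩ h) S c)
    (hint : chainIntegral h c = 0) : ∀ z ∈ S, ∃ u : Fin 3 → TangentSpace cylModel z,
      (∀ i, u i ∈ tangentSpaceOf cylModel S z) ∧ (∀ i, cylDθ z (u i) = 0) ∧
      (∀ c : Fin 3 → ℝ, ∑ i, c i • u i = 0 → ∀ i, c i = 0) ∧
      (cylVertical : TangentSpace cylModel z) ∈ tangentSpaceOf cylModel S z := by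
  obtain ⟨hcubes, -, hunion, -⟩ := hc
  have hrange : ∀ σ ∈ c.support, Set.range σ ⊆ S := fun σ hσ => by
    rw [← hunion]
    exact subset_biUnion_of_mem (u := fun σ : (Fin 3 → unitInterval) → M × Circle × ℝ => range σ) hσ
  have hneg : ∀ σ ∈ c.support, ∀ y ∈ Icc (0 : Fin 3 → ℝ) 1, _ := fun σ hσ y hy =>
    boxκKDθ_nonpos_of_specialLagrangian h hS (hcubes σ hσ).1 (hrange σ hσ) hy
      ((hcubes σ hσ).2.2.2 y hy)
  have hcont : ∀ σ ∈ c.support, ContinuousOn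
      (fun y => (c σ : ℝ) * boxκKDθ h (cubeExtend σ) 0 1 2 y) (Icc 0 1) := fun σ hσ =>
    (continuousOn_boxκKDθ h (hcubes σ hσ).1 0 1 2).const_smul (c σ : ℝ)
  rw [chainIntegral_eq_sum] at hint
  have hterm : ∀ σ ∈ c.support, (c σ : ℝ) * cubeIntegral h σ = 0 := by
    refine (Finset.sum_eq_zero_iff_of_nonpos fun σ hσ => ?_).1 hint
    rw [cubeIntegral, ← integral_const_mul]
    exact setIntegral_nonpos measurableSet_Icc fun y hy => (hneg σ hσ y hy).1
  have hzero : ∀ σ ∈ c.support, ∀ y ∈ Icc (0 : Fin 3 → ℝ) 1,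
      (c σ : ℝ) * boxκKDθ h (cubeExtend σ) 0 1 2 y = 0 := by
    intro σ hσ
    have h0 : ∫ y in Icc (0 : Fin 3 → ℝ) 1,
        -((c σ : ℝ) * boxκKDθ h (cubeExtend σ) 0 1 2 y) = 0 := by
      rw [integral_neg, integral_const_mul]
      simpa [cubeIntegral] using hterm σ hσ
    rw [setIntegral_eq_zero_iff_of_nonneg_ae
      ((ae_restrict_mem measurableSet_Icc).mono fun y hy => neg_nonneg.2 (hneg σ hσ y hy).1)
      ((hcont σ hσ).neg.integrableOn_compact isCompact_Icc)] at h0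
    have hcl : Icc (0 : Fin 3 → ℝ) 1 ⊆ closure (interior (Icc 0 1)) := by
      rw [(convex_Icc (𝕜 := ℝ) (0 : Fin 3 → ℝ) 1).closure_interior_eq_closure_of_nonempty_interior]
      · exact subset_closure
      · refine ⟨fun _ => 1 / 2, mem_interior_iff_mem_nhds.2 (unitBox_mem_nhds fun i _ => ?_)⟩
        norm_num
    intro y hy
    have := Measure.eqOn_of_ae_eq h0 (hcont σ hσ).neg continuousOn_const hcl hy
    simpa using this
  intro z hz
  rw [← hunion] at hz
  obtain ⟨σ, hσ, x, rfl⟩ : ∃ σ ∈ c.support, z ∈ Set.range σ := by simpa using hz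
  let y : Fin 3 → ℝ := fun i => x i
  have hy : y ∈ Icc (0 : Fin 3 → ℝ) 1 := ⟨fun i => (x i).2.1, fun i => (x i).2.2⟩
  rw [← cubeExtend_coe σ x]
  have hmem := cubePartial_mem_tangentSpaceOf (hcubes σ hσ).1 (hrange σ hσ) hy
  have hθ := (hneg σ hσ y hy).2 (hzero σ hσ y hy)
  have hω : ∀ i j, cylKahlerForm h (cubeExtend σ y) (cubePartial cylModel σ y i)
      (cubePartial cylModel σ y j) = 0 := fun i j =>
    (hS.2 _ (hrange σ hσ (cubeExtend_mem_range σ y)) ![cubePartial cylModel σ y i,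
      cubePartial cylModel σ y j, cubePartial cylModel σ y j]
      (by intro l; fin_cases l <;> exact hmem _)).1
  have hre : (cylVolumeForm h (cubeExtend σ y) (cubePartial cylModel σ y)).re ≠ 0 := by
    intro h0
    have := (hcubes σ hσ).2.2.2 y hy
    rw [cylReΩ, h0, mul_zero] at this
    exact this.false
  obtain ⟨hli, d, hd⟩ := linearIndependent_and_exists_sum_eq_cylVertical h hω hre hθ
  refine ⟨cubePartial cylModel σ y, hmem, hθ, hli, ?_⟩
  rw [← hd]
  exact Submodule.sum_mem _ fun i _ => Submodule.smul_mem _ _ (hmem i)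

end Calibration

/-! ### Flowing along `∂t` -/

section Flow

/-- An integral curve of a continuously differentiable vector field that is tangent to a linear
subspace `V` stays in `V` for a short time if it starts there. -/
theorem eventually_mem_of_hasDerivAt_of_tangent {E : Type*} [NormedAddCommGroup E]
    [NormedSpace ℝ E] [FiniteDimensional ℝ E] (V : Submodule ℝ E) {X : E → E} {γ : ℝ → E}
    (hX : ContDiffAt ℝ 1 X (γ 0)) (hV : ∀ᶠ v in 𝓝 (γ 0), v ∈ V → X v ∈ V) (h0 : γ 0 ∈ V)
    (hγ : ∀ᶠ s in 𝓝 0, HasDerivAt γ (X (γ s)) s) : ∀ᶠ s in 𝓝 0, γ s ∈ V := by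
  obtain ⟨p, hp⟩ := V.subtype.exists_leftInverse_of_injective V.ker_subtype
  have hpV : ∀ v ∈ V, (p v : E) = v := fun v hv =>
    congrArg Subtype.val (LinearMap.congr_fun hp ⟨v, hv⟩)
  let P : E →L[ℝ] E := (V.subtype ∘ₗ p).toContinuousLinearMap
  let q : E →L[ℝ] E := ContinuousLinearMap.id ℝ E - P
  have hPmem : ∀ v, P v ∈ V := fun v => (p v).2
  have hPV : ∀ v ∈ V, P v = v := hpV
  have hqV : ∀ v ∈ V, q v = 0 := fun v hv => by simp [q, hPV v hv]
  have hq : ∀ v, q v = v - P v := fun v => rfl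
  obtain ⟨K, T, hT, hLip⟩ := hX.exists_lipschitzOnWith
  have hPT : ∀ᶠ v in 𝓝 (γ 0), P v ∈ T ∧ (P v ∈ V → X (P v) ∈ V) := by
    have : Filter.Tendsto P (𝓝 (γ 0)) (𝓝 (γ 0)) := by
      have := P.continuous.tendsto (γ 0)
      rwa [hPV _ h0] at this
    exact this.eventually (Filter.Eventually.and hT hV)
  have hγc : Filter.Tendsto γ (𝓝 0) (𝓝 (γ 0)) := hγ.self_of_nhds.continuousAt
  obtain ⟨δ, hδ, hall⟩ := Metric.eventually_nhds_iff.1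
    (hγ.and (hγc.eventually (Filter.Eventually.and hT hPT)))
  have hbound : ∀ s, |s| < δ → ‖q (X (γ s))‖ ≤ ‖q‖ * K * ‖q (γ s)‖ := by
    intro s hs
    obtain ⟨-, h1, h2, h3⟩ := hall (y := s) (by simpa using hs)
    have hz : q (X (P (γ s))) = 0 := hqV _ (h3 (hPmem _))
    calc ‖q (X (γ s))‖ = ‖q (X (γ s) - X (P (γ s)))‖ := by rw [map_sub, hz, sub_zero]
      _ ≤ ‖q‖ * ‖X (γ s) - X (P (γ s))‖ := q.le_opNorm _
      _ ≤ ‖q‖ * (K * ‖γ s - P (γ s)‖) := by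
          gcongr
          exact hLip.norm_sub_le h1 h2
      _ = ‖q‖ * K * ‖q (γ s)‖ := by rw [hq, mul_assoc]
  have hder : ∀ s, |s| < δ → HasDerivAt (fun s => q (γ s)) (q (X (γ s))) s := fun s hs =>
    q.hasFDerivAt.comp_hasDerivAt s (hall (y := s) (by simpa using hs)).1
  have hq0 : q (γ 0) = 0 := hqV _ h0
  refine Metric.eventually_nhds_iff.2 ⟨δ, hδ, fun s hs => ?_⟩
  have hs' : |s| < δ := by simpa using hs
  suffices hz : q (γ s) = 0 by
    rw [hq, sub_eq_zero] at hz
    rw [hz]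
    exact hPmem _
  rcases le_total 0 s with hs0 | hs0
  · rw [abs_of_nonneg hs0] at hs'
    have hlt : ∀ r ∈ Icc 0 s, |r| < δ := fun r hr => by
      rw [abs_of_nonneg hr.1]; exact hr.2.trans_lt hs'
    exact eq_zero_of_abs_deriv_le_mul_abs_self_of_eq_zero_right (f := fun s => q (γ s))
      (fun r hr => (hder r (hlt r hr)).continuousAt.continuousWithinAt)
      (fun r hr => (hder r (hlt r ⟨hr.1, hr.2.le⟩)).hasDerivWithinAt) hq0
      (fun r hr => hbound r (hlt r ⟨hr.1, hr.2.le⟩)) s ⟨hs0, le_rfl⟩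
  · rw [abs_of_nonpos hs0] at hs'
    have hlt : ∀ r ∈ Icc 0 (-s), |(-r)| < δ := fun r hr => by
      rw [abs_neg, abs_of_nonneg hr.1]; exact hr.2.trans_lt hs'
    have hder' : ∀ r ∈ Icc 0 (-s), HasDerivAt (fun r => q (γ (-r))) (-q (X (γ (-r)))) r := by
      intro r hr
      have := (hder (-r) (hlt r hr)).scomp r (hasDerivAt_neg r)
      rw [neg_one_smul] at this
      exact this
    have := eq_zero_of_abs_deriv_le_mul_abs_self_of_eq_zero_right (f := fun r => q (γ (-r)))
      (K := ‖q‖ * K)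
      (fun r hr => (hder' r hr).continuousAt.continuousWithinAt)
      (fun r hr => (hder' r ⟨hr.1, hr.2.le⟩).hasDerivWithinAt) (by simpa using hq0)
      (fun r hr => by simpa using hbound (-r) (hlt r ⟨hr.1, hr.2.le⟩)) (-s)
      ⟨by linarith, le_rfl⟩
    simpa using this

end Flow

section Transition

variable {E : Type*} [NormedAddCommGroup E] [NormedSpace ℝ E]
  {H : Type*} [TopologicalSpace H] {I : ModelWithCorners ℝ E H} [I.Boundaryless]
  {Z : Type*} [TopologicalSpace Z] [ChartedSpace H Z]

/-- The transition maps between charts of the maximal atlas are smooth. -/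
theorem contDiffAt_extend_comp_extend_symm {φ φ' : OpenPartialHomeomorph Z H}
    (hφ : φ ∈ IsManifold.maximalAtlas I ∞ Z) (hφ' : φ' ∈ IsManifold.maximalAtlas I ∞ Z) {w : Z}
    (hw : w ∈ φ.source) (hw' : w ∈ φ'.source) :
    ContDiffAt ℝ ∞ (φ'.extend I ∘ (φ.extend I).symm) (φ.extend I w) := by
  rw [← contMDiffAt_iff_contDiffAt]
  have hsymm : ContMDiffAt 𝓘(ℝ, E) I ∞ (φ.extend I).symm (φ.extend I w) := by
    have h1 : ContMDiff 𝓘(ℝ, E) I ∞ I.symm := by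
      rw [← contMDiffOn_univ, ← I.range_eq_univ]
      exact I.contMDiffOn_symm
    have hmem : I.symm (φ.extend I w) ∈ φ.target := by
      simpa using φ.map_source hw
    exact (contMDiffAt_symm_of_mem_maximalAtlas hφ hmem).comp _ h1.contMDiffAt
  have hl : (φ.extend I).symm (φ.extend I w) = w := φ.extend_left_inv hw
  refine ContMDiffAt.comp (φ.extend I w) ?_ hsymm
  rw [hl]
  exact φ'.contMDiffAt_extend hφ' hw'

end Transition

section Shift

variable {M : Type*} [TopologicalSpace M] [ChartedSpace (EuclideanSpace ℝ (Fin 4)) M]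

/-- The translations of the cylinder along its axis, which are the flow of `∂t`. -/
def cylShift (s : ℝ) (w : M × Circle × ℝ) : M × Circle × ℝ := (w.1, w.2.1, w.2.2 + s)

theorem cylShift_mem_source {z w : M × Circle × ℝ} (hw : w ∈ (extChartAt cylModel z).source)
    (s : ℝ) : cylShift s w ∈ (extChartAt cylModel z).source := by
  rw [extChartAt_source] at hw ⊢
  exact ⟨hw.1, hw.2.1, trivial⟩

theorem extChartAt_cylShift (z w : M × Circle × ℝ) (s : ℝ) :
    extChartAt cylModel z (cylShift s w) = extChartAt cylModel z w + s • cylVertical := by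
  have : ∀ w : M × Circle × ℝ, extChartAt cylModel z w =
      (extChartAt (𝓡 4) z.1 w.1, extChartAt (𝓡 1) z.2.1 w.2.1, w.2.2) := fun w => rfl
  rw [this, this]
  simp [cylShift, cylVertical]

variable [IsManifold (𝓡 4) ∞ M]

/-- The image of `∂t` under the derivative of a chart, computed by means of an arbitrary
preferred chart. -/
theorem hasDerivAt_extend_cylShift
    {φ : OpenPartialHomeomorph (M × Circle × ℝ) (ModelProd (EuclideanSpace ℝ (Fin 4))
      (ModelProd (EuclideanSpace ℝ (Fin 1)) ℝ))}
    (hφ : φ ∈ IsManifold.maximalAtlas cylModel ∞ (M × Circle × ℝ)) {w z : M × Circle × ℝ}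
    (hw : w ∈ φ.source) (hz : w ∈ (extChartAt cylModel z).source) :
    HasDerivAt (fun s => φ.extend cylModel (cylShift s w))
      (fderiv ℝ (φ.extend cylModel ∘ (extChartAt cylModel z).symm) (extChartAt cylModel z w)
        cylVertical) 0 := by
  have h1 : ContDiffAt ℝ ∞ (φ.extend cylModel ∘ (extChartAt cylModel z).symm)
      (extChartAt cylModel z w) := contDiffAt_extend_comp_extend_symm
    (IsManifold.chart_mem_maximalAtlas (I := cylModel) (n := ∞) z) hφ
    (by simpa using hz) hw
  have h2 := (h1.differentiableAt (by simp)).hasFDerivAt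
  have h3 : HasDerivAt (fun s : ℝ => extChartAt cylModel z w + s • cylVertical) cylVertical 0 := by
    simpa using ((hasDerivAt_id (0 : ℝ)).smul_const cylVertical).const_add
      (extChartAt cylModel z w)
  have h4 := HasFDerivAt.comp_hasDerivAt (0 : ℝ)
    (f := fun s : ℝ => extChartAt cylModel z w + s • cylVertical) (by simpa using h2) h3
  refine h4.congr_of_eventuallyEq (Filter.Eventually.of_forall fun s => ?_)
  simp only [Function.comp_apply]
  rw [← extChartAt_cylShift]
  exact congrArg (φ.extend cylModel)
    ((extChartAt cylModel z).left_inv (cylShift_mem_source hz s)).symm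

/-- At the points of a slice chart, the derivative of the chart maps the tangent space of the
submanifold to the model subspace. -/
theorem fderiv_extend_mem_of_mem_tangentSpaceOf {S : Set (M × Circle × ℝ)}
    {φ : OpenPartialHomeomorph (M × Circle × ℝ) (ModelProd (EuclideanSpace ℝ (Fin 4))
      (ModelProd (EuclideanSpace ℝ (Fin 1)) ℝ))}
    (hφ : φ ∈ IsManifold.maximalAtlas cylModel ∞ (M × Circle × ℝ))
    {V : Submodule ℝ (EuclideanSpace ℝ (Fin 4) × EuclideanSpace ℝ (Fin 1) × ℝ)}
    (hV : ∀ y ∈ φ.source, (y ∈ S ↔ φ.extend cylModel y ∈ V)) {w : M × Circle × ℝ}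
    (hw : w ∈ φ.source) (hwS : w ∈ S) {u : TangentSpace cylModel w}
    (hu : u ∈ tangentSpaceOf cylModel S w) :
    fderiv ℝ (φ.extend cylModel ∘ (extChartAt cylModel w).symm) (extChartAt cylModel w w) u ∈
      V := by
  have h1 : ContDiffAt ℝ ∞ (φ.extend cylModel ∘ (extChartAt cylModel w).symm)
      (extChartAt cylModel w w) := contDiffAt_extend_comp_extend_symm
    (IsManifold.chart_mem_maximalAtlas (I := cylModel) (n := ∞) w) hφ (mem_chart_source _ w) hw
  have hU : (extChartAt cylModel w).symm ⁻¹' φ.source ∈ 𝓝 (extChartAt cylModel w w) := by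
    refine (continuousAt_extChartAt_symm w).preimage_mem_nhds ?_
    rw [extChartAt_to_inv]
    exact φ.open_source.mem_nhds hw
  refine fderiv_mem_of_mem_tangentSpaceOf (h1.differentiableAt (by simp)).hasFDerivAt
    V.closed_of_finiteDimensional hU ?_ hwS hu
  rintro y ⟨hyS, hy⟩ hyU
  rw [mem_preimage, (extChartAt cylModel w).left_inv hy] at hyU
  rw [Function.comp_apply, (extChartAt cylModel w).left_inv hy]
  exact (hV y hyU).1 hyS

/-- A submanifold whose tangent spaces contain `∂t` is locally invariant under translations along
the axis, away from its boundary. -/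
theorem eventually_cylShift_mem {S : Set (M × Circle × ℝ)}
    (hS : ∀ w ∈ S, (cylVertical : TangentSpace cylModel w) ∈ tangentSpaceOf cylModel S w)
    {k : ℕ} {z : M × Circle × ℝ} (hz : z ∈ S) (hsl : IsSliceAt cylModel k S z) :
    ∀ᶠ s in 𝓝 (0 : ℝ), cylShift s z ∈ S := by
  obtain ⟨φ, hφ, hzφ, V, -, hV⟩ := hsl
  let c := extChartAt cylModel z
  let ψ := φ.extend cylModel ∘ c.symm
  let γ : ℝ → EuclideanSpace ℝ (Fin 4) × EuclideanSpace ℝ (Fin 1) × ℝ :=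
    fun s => φ.extend cylModel (cylShift s z)
  -- the vector field `∂t` in the chart `φ`
  let X : EuclideanSpace ℝ (Fin 4) × EuclideanSpace ℝ (Fin 1) × ℝ →
      EuclideanSpace ℝ (Fin 4) × EuclideanSpace ℝ (Fin 1) × ℝ :=
    fun v => fderiv ℝ ψ ((c ∘ (φ.extend cylModel).symm) v) cylVertical
  have hcz : z ∈ c.source := mem_extChartAt_source z
  have hshift0 : cylShift 0 z = z := by simp [cylShift]
  have hγ0 : γ 0 = φ.extend cylModel z := by simp only [γ, hshift0]
  have hleft : ∀ w ∈ φ.source, (φ.extend cylModel).symm (φ.extend cylModel w) = w :=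
    fun w hw => φ.extend_left_inv hw
  have hcont : Continuous fun s : ℝ => cylShift s z := by unfold cylShift; fun_prop
  have hsrc : ∀ᶠ s in 𝓝 (0 : ℝ), cylShift s z ∈ φ.source :=
    hcont.continuousAt.eventually (φ.open_source.mem_nhds (by simpa only [hshift0] using hzφ))
  have hψ : ContDiffAt ℝ ∞ ψ (c z) := contDiffAt_extend_comp_extend_symm
    (IsManifold.chart_mem_maximalAtlas (I := cylModel) (n := ∞) z) hφ (mem_chart_source _ z) hzφ
  have hψ' : ContDiffAt ℝ ∞ (c ∘ (φ.extend cylModel).symm) (γ 0) := by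
    rw [hγ0]
    exact contDiffAt_extend_comp_extend_symm hφ
      (IsManifold.chart_mem_maximalAtlas (I := cylModel) (n := ∞) z) hzφ (mem_chart_source _ z)
  have hX : ContDiffAt ℝ 1 X (γ 0) := by
    have h1 : ContDiffAt ℝ 1 (fderiv ℝ ψ) ((c ∘ (φ.extend cylModel).symm) (γ 0)) := by
      rw [Function.comp_apply, hγ0, hleft z hzφ]
      exact hψ.fderiv_right two_le_infty
    exact (h1.comp (γ 0) (hψ'.of_le (by simp))).clm_apply contDiffAt_const
  have hder : ∀ w ∈ φ.source, w ∈ c.source →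
      HasDerivAt (fun s => φ.extend cylModel (cylShift s w)) (X (φ.extend cylModel w)) 0 := by
    intro w hw hwc
    simp only [X, Function.comp_apply, hleft w hw]
    exact hasDerivAt_extend_cylShift hφ hw hwc
  have hXV : ∀ᶠ v in 𝓝 (γ 0), v ∈ V → X v ∈ V := by
    have ht : ∀ᶠ v in 𝓝 (γ 0), v ∈ (φ.extend cylModel).target := by
      rw [hγ0]
      exact (φ.isOpen_extend_target (I := cylModel)).mem_nhds
        ((φ.extend cylModel).map_source (by rwa [φ.extend_source]))
    have hs : ∀ᶠ v in 𝓝 (γ 0), (φ.extend cylModel).symm v ∈ c.source := by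
      rw [hγ0]
      refine (φ.continuousAt_extend_symm hzφ).eventually ?_
      rw [hleft z hzφ]
      exact extChartAt_source_mem_nhds z
    filter_upwards [ht, hs] with v hvt hvs hvV
    have hvφ : (φ.extend cylModel).symm v ∈ φ.source := by
      have := (φ.extend cylModel).map_target hvt
      rwa [φ.extend_source] at this
    have hvr := (φ.extend cylModel).right_inv hvt
    have hvS : (φ.extend cylModel).symm v ∈ S := by
      rw [hV _ hvφ, hvr]
      exact hvV
    have h1 := hder _ hvφ hvs
    rw [hvr] at h1
    have h2 := hasDerivAt_extend_cylShift hφ hvφ (mem_extChartAt_source _)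
    rw [h1.unique h2]
    exact fderiv_extend_mem_of_mem_tangentSpaceOf hφ hV hvφ hvS (hS _ hvS)
  have hγ : ∀ᶠ s in 𝓝 (0 : ℝ), HasDerivAt γ (X (γ s)) s := by
    filter_upwards [hsrc] with s hs
    have h1 := hder (cylShift s z) hs (cylShift_mem_source hcz s)
    rw [← sub_self s] at h1
    have h2 := h1.comp_sub_const s s
    refine h2.congr_of_eventuallyEq (Filter.Eventually.of_forall fun r => ?_)
    simp [γ, cylShift]
  have hfin := eventually_mem_of_hasDerivAt_of_tangent V hX hXV
    (by rw [hγ0]; exact (hV z hzφ).1 hz) hγ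
  filter_upwards [hfin, hsrc] with s hs hsφ
  exact (hV _ hsφ).2 hs

end Shift

/-! ### Splitting into vertical segments -/

section HalfSlices

variable {E : Type*} [NormedAddCommGroup E] [NormedSpace ℝ E]
  {H : Type*} [TopologicalSpace H] {I : ModelWithCorners ℝ E H} [I.Boundaryless]
  {Z : Type*} [TopologicalSpace Z] [ChartedSpace H Z]

/-- The boundary points of a submanifold are limits of points at which it is a slice. -/
theorem IsHalfSliceAt.mem_closure_isSliceAt {k : ℕ} {S : Set Z} {z : Z}
    (h : IsHalfSliceAt I k S z) (hz : z ∈ S) : z ∈ closure {w ∈ S | IsSliceAt I k S w} := by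
  obtain ⟨φ, hφ, hzφ, V, hVk, ℓ, ⟨v, hv, hℓv⟩, hℓz, hV⟩ := h
  obtain ⟨v, hv, hℓv⟩ : ∃ v ∈ V, 0 < ℓ v := by
    rcases hℓv.lt_or_gt with hneg | hpos
    · exact ⟨-v, V.neg_mem hv, by simpa using hneg⟩
    · exact ⟨v, hv, hpos⟩
  let e : ℝ → E := fun s => φ.extend I z + s • v
  have he : Continuous e := by fun_prop
  have he0 : e 0 = φ.extend I z := by simp [e]
  have htarget : ∀ᶠ s in 𝓝 (0 : ℝ), e s ∈ (φ.extend I).target := by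
    refine he.continuousAt.eventually ((φ.isOpen_extend_target (I := I)).mem_nhds ?_)
    rw [he0]
    exact (φ.extend I).map_source (by rwa [φ.extend_source])
  have hlim : Filter.Tendsto (fun s => (φ.extend I).symm (e s)) (𝓝[>] 0) (𝓝 z) := by
    have h1 : Filter.Tendsto (φ.extend I).symm (𝓝 (e 0)) (𝓝 z) := by
      have := φ.continuousAt_extend_symm (I := I) hzφ
      rw [ContinuousAt, φ.extend_left_inv hzφ] at this
      rwa [he0]
    exact (h1.comp he.continuousAt).mono_left nhdsWithin_le_nhds
  refine mem_closure_of_tendsto hlim ?_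
  filter_upwards [nhdsWithin_le_nhds htarget, self_mem_nhdsWithin] with s hs hs0
  have hs0' : 0 < s := hs0
  have hsφ : (φ.extend I).symm (e s) ∈ φ.source := by
    have := (φ.extend I).map_target hs
    rwa [φ.extend_source] at this
  have hr := (φ.extend I).right_inv hs
  have hVz := ((hV z hzφ).1 hz).1
  have hes : e s ∈ V := V.add_mem hVz (V.smul_mem _ hv)
  have hℓs : 0 < ℓ (e s) := by
    simp only [e, map_add, map_smul, hℓz, smul_eq_mul, zero_add]
    positivity
  refine ⟨(hV _ hsφ).2 (by rw [hr]; exact ⟨hes, hℓs.le⟩), ?_⟩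
  -- away from the edge, the half-slice chart is a slice chart
  let O : Set Z := φ.source ∩ φ.extend I ⁻¹' {x | 0 < ℓ x}
  have hφc : ContinuousOn (φ.extend I) φ.source := by
    simpa only [φ.extend_source] using φ.continuousOn_extend (I := I)
  have hO : IsOpen O := hφc.isOpen_inter_preimage φ.open_source
    (isOpen_lt continuous_const ℓ.continuous)
  refine ⟨φ.restr O, restr_mem_maximalAtlas _ hφ hO, ?_, V, hVk, ?_⟩
  · rw [φ.restr_source, hO.interior_eq]
    refine ⟨hsφ, hsφ, ?_⟩
    rw [mem_preimage, hr]
    exact hℓs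
  · intro y hy
    rw [φ.restr_source, hO.interior_eq] at hy
    have hy2 : 0 < ℓ (φ.extend I y) := hy.2.2
    exact (hV y hy.1).trans (and_iff_left hy2.le)

end HalfSlices

section Lines

variable {M : Type*} [TopologicalSpace M] [ChartedSpace (EuclideanSpace ℝ (Fin 4)) M]

/-- A submanifold that has a fundamental chain is compact: it is a finite union of cubes. -/
theorem IsFundamentalChain.isCompact {k : ℕ}
    {o : ∀ z : M × Circle × ℝ, (Fin (k + 1) → TangentSpace cylModel z) → ℝ}
    {S : Set (M × Circle × ℝ)} {c : CubeChain (M × Circle × ℝ) (k + 1)}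
    (hc : IsFundamentalChain cylModel k o S c) : IsCompact S := by
  rw [← hc.2.2.1]
  refine c.support.isCompact_biUnion fun σ hσ => ?_
  have hr : Set.range σ = cubeExtend σ '' Icc 0 1 := by
    ext z
    constructor
    · rintro ⟨x, rfl⟩
      exact ⟨fun i => x i, ⟨fun i => (x i).2.1, fun i => (x i).2.2⟩, cubeExtend_coe σ x⟩
    · rintro ⟨y, -, rfl⟩
      exact cubeExtend_mem_range σ y
  rw [hr]
  exact isCompact_Icc.image_of_continuousOn (hc.1 σ hσ).1.continuousOn

variable [IsManifold (𝓡 4) ∞ M]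

/-- A closed submanifold of `M × S¹ × [a, b]` with boundary in `M × {p} × {a, b}` whose tangent
spaces contain `∂t` is a union of segments `{(x, p)} × [a, b]`. -/
theorem segment_subset_of_cylVertical_mem {S : Set (M × Circle × ℝ)} {a b : ℝ} (hab : a < b)
    {p : Circle} (hclosed : IsClosed S)
    (hX : S ⊆ univ ×ˢ (univ : Set Circle) ×ˢ Icc a b)
    (hA : submanifoldBoundary cylModel 3 S ⊆ univ ×ˢ ({p} : Set Circle) ×ˢ ({a, b} : Set ℝ))
    (hS : IsSubmanifoldWithBoundary cylModel 3 S)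
    (ht : ∀ w ∈ S, (cylVertical : TangentSpace cylModel w) ∈ tangentSpaceOf cylModel S w) :
    ∀ z ∈ S, z.2.1 = p ∧ ∀ t ∈ Icc a b, (z.1, z.2.1, t) ∈ S := by
  have hslice : ∀ z ∈ S, IsSliceAt cylModel 3 S z → z.2.2 ∈ Ioo a b := by
    intro z hz hsl
    obtain ⟨δ, hδ, hball⟩ := Metric.eventually_nhds_iff.1 (eventually_cylShift_mem ht hz hsl)
    have h1 := (hX (hball (y := δ / 2) (by simp [abs_of_pos hδ, hδ]))).2.2.2
    have h2 := (hX (hball (y := -(δ / 2)) (by simp [abs_of_pos hδ, hδ]))).2.2.1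
    simp only [cylShift] at h1 h2
    constructor <;> linarith
  have hint : ∀ z ∈ S, z.2.2 ∈ Ioo a b → IsSliceAt cylModel 3 S z := by
    intro z hz hzt
    refine (hS z hz).resolve_right fun hh => ?_
    rcases (hA ⟨hz, hh⟩).2.2 with h1 | h1
    · exact hzt.1.ne' h1
    · exact hzt.2.ne h1
  have hline : ∀ z ∈ S, z.2.2 ∈ Ioo a b → ∀ t ∈ Icc a b, (z.1, z.2.1, t) ∈ S := by
    intro z hz hzt
    let j : ℝ → M × Circle × ℝ := fun t => (z.1, z.2.1, t)
    have hj : Continuous j := by fun_prop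
    have hTc : IsClosed (j ⁻¹' S) := hclosed.preimage hj
    have hopen : IsOpen (j ⁻¹' S ∩ Ioo a b) := by
      rw [isOpen_iff_mem_nhds]
      rintro t ⟨htS, htI⟩
      have hev := eventually_cylShift_mem ht htS (hint _ htS htI)
      have hsub : Filter.Tendsto (fun r => r - t) (𝓝 t) (𝓝 0) := by
        have : Continuous fun r : ℝ => r - t := by fun_prop
        exact this.tendsto' t 0 (sub_self t)
      filter_upwards [hsub.eventually hev, isOpen_Ioo.mem_nhds htI] with r hr hrI
      refine ⟨?_, hrI⟩
      simpa [j, cylShift] using hr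
    have hIoo : Ioo a b ⊆ j ⁻¹' S ∩ Ioo a b :=
      isPreconnected_Ioo.subset_of_closure_inter_subset hopen ⟨z.2.2, hzt, hz, hzt⟩
        fun t ht' => ⟨hTc.closure_subset_iff.2 inter_subset_left ht'.1, ht'.2⟩
    rw [← closure_Ioo hab.ne]
    exact hTc.closure_subset_iff.2 (hIoo.trans inter_subset_left)
  have hall : ∀ z ∈ S, ∀ t ∈ Icc a b, (z.1, z.2.1, t) ∈ S := by
    intro z hz t htI
    rcases hS z hz with hsl | hh
    · exact hline z hz (hslice z hz hsl) t htI
    · have hcl := hh.mem_closure_isSliceAt hz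
      have hc : Continuous fun w : M × Circle × ℝ => (w.1, w.2.1, t) := by fun_prop
      have hmaps : MapsTo (fun w : M × Circle × ℝ => (w.1, w.2.1, t))
          {w ∈ S | IsSliceAt cylModel 3 S w} S :=
        fun w hw => hline w hw.1 (hslice w hw.1 hw.2) t htI
      exact hclosed.closure_subset_iff.2 subset_rfl (hmaps.closure hc hcl)
  refine fun z hz => ⟨?_, hall z hz⟩
  have ha := hall z hz a ⟨le_rfl, hab.le⟩
  rcases hS _ ha with hsl | hh
  · exact absurd (hslice _ ha hsl).1 (lt_irrefl a)
  · exact (hA ⟨ha, hh⟩).2.1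

end Lines

/-! ### Recognizing slices up to a local diffeomorphism -/

section Germs

variable {E F : Type*} [NormedAddCommGroup E] [NormedSpace ℝ E] [NormedAddCommGroup F]
  [NormedSpace ℝ F]

/-- A set is a slice near `x` as soon as a local diffeomorphism `k` of the model space identifies
it, near `x` and in the preferred chart, with a linear subspace. -/
theorem isSliceAt_of_eventually [CompleteSpace F] {M : Type*} [TopologicalSpace M]
    [ChartedSpace F M] [IsManifold 𝓘(ℝ, F) ∞ M] {d : ℕ} {S : Set M} {x : M} {k : F → F}
    (hk : ∀ᶠ y in 𝓝 (chartAt F x x), ContDiffAt ℝ ∞ k y) {k' : F ≃L[ℝ] F}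
    (hk' : HasFDerivAt k (k' : F →L[ℝ] F) (chartAt F x x)) {V : Submodule ℝ F}
    (hV : Module.finrank ℝ V = d)
    (hS : ∀ᶠ y in 𝓝 (chartAt F x x), ((chartAt F x).symm y ∈ S ↔ k y ∈ V)) :
    IsSliceAt 𝓘(ℝ, F) d S x := by
  have hk0 : ContDiffAt ℝ ∞ k (chartAt F x x) := hk.self_of_nhds
  have hinv : ∀ᶠ y in 𝓝 (chartAt F x x), ∃ e : F ≃L[ℝ] F, HasFDerivAt k (e : F →L[ℝ] F) y := by
    have hc : ContinuousAt (fderiv ℝ k) (chartAt F x x) :=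
      (hk0.fderiv_right (m := 1) two_le_infty).continuousAt
    have hn : range ((↑) : (F ≃L[ℝ] F) → F →L[ℝ] F) ∈ 𝓝 (fderiv ℝ k (chartAt F x x)) := by
      rw [hk'.fderiv]
      exact ContinuousLinearEquiv.nhds k'
    filter_upwards [hc hn, hk] with y ⟨e, he⟩ hy
    exact ⟨e, by rw [he]; exact (hy.differentiableAt (by simp)).hasFDerivAt⟩
  obtain ⟨O, hO, hOo, hxO⟩ := eventually_nhds_iff.1 (hk.and (hinv.and hS))
  let K := hk0.toOpenPartialHomeomorph k hk' (by simp)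
  let K₁ := K.restr O
  have hK₁ : K₁.source = K.source ∩ O := by rw [K.restr_source, hOo.interior_eq]
  let Φ := (chartAt F x).trans K₁
  have hxK : chartAt F x x ∈ K₁.source := by
    rw [hK₁]
    exact ⟨hk0.mem_toOpenPartialHomeomorph_source hk' (by simp), hxO⟩
  have hsrc : ∀ y ∈ Φ.source, y ∈ (chartAt F x).source ∧ chartAt F x y ∈ O := by
    intro y hy
    rw [OpenPartialHomeomorph.trans_source] at hy
    exact ⟨hy.1, (hK₁ ▸ hy.2 : chartAt F x y ∈ K.source ∩ O).2⟩
  refine ⟨Φ, Φ.mem_maximalAtlas_of_contMDiffOn ?_ ?_, ?_, V, hV, ?_⟩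
  · intro y hy
    obtain ⟨h1, h2⟩ := hsrc y hy
    have h3 : ContMDiffAt 𝓘(ℝ, F) 𝓘(ℝ, F) ∞ k (chartAt F x y) := (hO _ h2).1.contMDiffAt
    exact (h3.comp y (contMDiffAt_of_mem_maximalAtlas
      (IsManifold.chart_mem_maximalAtlas x) h1)).contMDiffWithinAt
  · intro v hv
    rw [OpenPartialHomeomorph.trans_target] at hv
    have h1 : K₁.symm v ∈ O := by
      have := K₁.map_target hv.1
      rw [hK₁] at this
      exact this.2
    obtain ⟨h2, ⟨e, he⟩, -⟩ := hO _ h1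
    have h3 : ContMDiffAt 𝓘(ℝ, F) 𝓘(ℝ, F) ∞ K₁.symm v :=
      (K₁.contDiffAt_symm hv.1 he h2).contMDiffAt
    exact ((contMDiffAt_symm_of_mem_maximalAtlas (IsManifold.chart_mem_maximalAtlas x)
      hv.2).comp v h3).contMDiffWithinAt
  · rw [OpenPartialHomeomorph.trans_source]
    exact ⟨mem_chart_source F x, hxK⟩
  · intro y hy
    obtain ⟨h1, h2⟩ := hsrc y hy
    have h3 := (hO _ h2).2.2
    rwa [(chartAt F x).left_inv h1] at h3

/-- Let `j` be a section of a smooth map `r : E → F`, and let `V` be a subspace of `E` which `r`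
maps into a set `N`. If `j` maps exactly the points of `N` to `V`, then near `y₀` the map
`D r ∘ j` maps exactly the points of `N` to the image of `V` under `D r`. -/
theorem eventually_mem_iff_fderiv_mem_map [FiniteDimensional ℝ E] [FiniteDimensional ℝ F]
    {j : F → E} {r : E → F} {y₀ : F} {V : Submodule ℝ E} {N : Set F}
    {j' : F →L[ℝ] E} {r' : E →L[ℝ] F} (hj : HasStrictFDerivAt j j' y₀)
    (hr : HasStrictFDerivAt r r' (j y₀)) (hrj : ∀ᶠ y in 𝓝 y₀, r (j y) = y) (hjV : j y₀ ∈ V)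
    (hN : ∀ᶠ y in 𝓝 y₀, (y ∈ N ↔ j y ∈ V)) (hVN : ∀ᶠ v in 𝓝 (j y₀), v ∈ V → r v ∈ N) :
    ∀ᶠ y in 𝓝 y₀, (y ∈ N ↔ r' (j y) ∈ V.map r'.toLinearMap) := by
  have hr0 : r (j y₀) = y₀ := hrj.self_of_nhds
  have hid : r'.comp j' = ContinuousLinearMap.id ℝ F := by
    refine (hr.hasFDerivAt.comp y₀ hj.hasFDerivAt).unique ?_
    exact (hasFDerivAt_id y₀).congr_of_eventuallyEq hrj
  have hk : HasStrictFDerivAt (fun y => r' (j y)) ((ContinuousLinearEquiv.refl ℝ F : F ≃L[ℝ] F) :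
      F →L[ℝ] F) y₀ := by
    have := r'.hasStrictFDerivAt.comp y₀ hj
    rw [hid] at this
    exact this
  let W := V.map r'.toLinearMap
  obtain ⟨π, hπ⟩ := W.subtype.exists_leftInverse_of_injective W.ker_subtype
  have hπW : ∀ w (hw : w ∈ W), π w = ⟨w, hw⟩ := fun w hw => LinearMap.congr_fun hπ ⟨w, hw⟩
  let π' : F →L[ℝ] W := π.toContinuousLinearMap
  let v₀ : V := ⟨j y₀, hjV⟩
  let m' : V →L[ℝ] W := π'.comp (r'.comp V.subtypeL)
  have hm : HasStrictFDerivAt (fun v : V => π' (r' (j (r v)))) m' v₀ := by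
    have h1 : HasStrictFDerivAt (fun v : V => r v) (r'.comp V.subtypeL) v₀ :=
      HasStrictFDerivAt.comp (g := r) v₀ hr V.subtypeL.hasStrictFDerivAt
    have h2 : HasStrictFDerivAt (fun y => r' (j y)) ((ContinuousLinearEquiv.refl ℝ F : F ≃L[ℝ] F) :
      F →L[ℝ] F) (r (v₀ : E)) := by
      change HasStrictFDerivAt _ _ (r (j y₀))
      rwa [hr0]
    exact π'.hasStrictFDerivAt.comp v₀ (HasStrictFDerivAt.comp (g := fun y => r' (j y)) v₀ h2 h1)
  have hsurj : m'.range = ⊤ := by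
    rw [LinearMap.range_eq_top]
    rintro ⟨w, hw⟩
    obtain ⟨v, hv, rfl⟩ := hw
    exact ⟨⟨v, hv⟩, hπW _ _⟩
  have hopen := hm.map_nhds_eq_of_surj hsurj
  have hleft := hk.eventually_left_inverse
  have hkN : ∀ᶠ y in 𝓝 y₀, y ∈ N → r' (j y) ∈ W := by
    filter_upwards [hN] with y hy hyN
    exact ⟨j y, hy.1 hyN, rfl⟩
  have hrv : Filter.Tendsto (fun v : V => r v) (𝓝 v₀) (𝓝 y₀) := by
    have h1 : Filter.Tendsto r (𝓝 (j y₀)) (𝓝 y₀) := by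
      have := hr.continuousAt.tendsto
      rwa [hr0] at this
    exact h1.comp (continuous_subtype_val.tendsto v₀)
  have hgood : ∀ᶠ v : V in 𝓝 v₀, r v ∈ N ∧ r' (j (r v)) ∈ W ∧
      hk.localInverse _ _ _ (r' (j (r v))) = r v := by
    filter_upwards [continuous_subtype_val.continuousAt.eventually hVN, hrv.eventually hkN,
      hrv.eventually hleft] with v h1 h2 h3
    exact ⟨h1 v.2, h2 (h1 v.2), h3⟩
  have himage := Filter.image_mem_map (m := fun v : V => π' (r' (j (r v)))) hgood
  rw [hopen] at himage
  have hky : Filter.Tendsto (fun y => π' (r' (j y))) (𝓝 y₀) (𝓝 (π' (r' (j (r v₀))))) := by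
    change Filter.Tendsto _ _ (𝓝 (π' (r' (j (r (j y₀))))))
    rw [hr0]
    exact (π'.continuous.comp r'.continuous).continuousAt.tendsto.comp hj.continuousAt.tendsto
  filter_upwards [hkN, hleft, hky himage] with y h1 h2 h3
  refine ⟨h1, fun hyW => ?_⟩
  obtain ⟨v, ⟨hvN, hvW, hv⟩, heq⟩ := h3
  have heq' : r' (j (r v)) = r' (j y) := by
    have := congrArg Subtype.val heq
    change (π _ : F) = (π _ : F) at this
    rwa [hπW _ hvW, hπW _ hyW] at this
  rw [heq', h2] at hv
  rwa [hv]

end Germs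

/-! ### Cross-sections -/

section Projection

/-- Dropping the direction of `∂t` lowers the dimension by one. -/
theorem finrank_map_fst_of_vertical_mem {A B : Type*} [NormedAddCommGroup A] [NormedSpace ℝ A]
    [FiniteDimensional ℝ A] [NormedAddCommGroup B] [NormedSpace ℝ B] [FiniteDimensional ℝ B]
    {d : ℕ} {T : Submodule ℝ (A × B × ℝ)} (hd : Module.finrank ℝ T = d + 1)
    (hT : ∀ w ∈ T, w.2.1 = 0) (ht : ((0, 0, 1) : A × B × ℝ) ∈ T) :
    Module.finrank ℝ (T.map (LinearMap.fst ℝ A (B × ℝ))) = d := by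
  let f := (LinearMap.fst ℝ A (B × ℝ)).domRestrict T
  have hker : Module.finrank ℝ f.ker = 1 := by
    let v : f.ker := ⟨⟨(0, 0, 1), ht⟩, rfl⟩
    refine (finrank_eq_one_iff_of_nonzero' (K := ℝ) v fun h0 => ?_).2 ?_
    · have : (1 : ℝ) = 0 := congrArg (fun w : f.ker => ((w : T) : A × B × ℝ).2.2) h0
      exact one_ne_zero this
    · rintro ⟨⟨⟨w1, w2, w3⟩, hw⟩, hw0⟩
      refine ⟨w3, ?_⟩
      have h1 : w1 = 0 := hw0
      have h2 : w2 = 0 := hT _ hw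
      subst h1 h2
      ext <;> simp [v]
  have hrange : f.range = T.map (LinearMap.fst ℝ A (B × ℝ)) := by
    ext y
    constructor
    · rintro ⟨w, rfl⟩
      exact ⟨w, w.2, rfl⟩
    · rintro ⟨w, hw, rfl⟩
      exact ⟨⟨w, hw⟩, rfl⟩
  have := f.finrank_range_add_finrank_ker
  rw [hker, hrange, hd] at this
  omega

end Projection

section CrossSection

variable {M : Type*} [TopologicalSpace M] [ChartedSpace (EuclideanSpace ℝ (Fin 4)) M]

/-- The inclusion of the chart of `M` as a horizontal slice of the product chart. -/
noncomputable def cylIncl (z : M × Circle × ℝ) (y : EuclideanSpace ℝ (Fin 4)) :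
    EuclideanSpace ℝ (Fin 4) × EuclideanSpace ℝ (Fin 1) × ℝ := (y, (extChartAt cylModel z z).2)

theorem extChartAt_symm_cylIncl (z : M × Circle × ℝ) (y : EuclideanSpace ℝ (Fin 4)) :
    (extChartAt cylModel z).symm (cylIncl z y) = ((extChartAt (𝓡 4) z.1).symm y, z.2) := by
  have h : (extChartAt cylModel z).symm (cylIncl z y) = ((extChartAt (𝓡 4) z.1).symm y,
      (extChartAt (𝓡 1) z.2.1).symm (extChartAt (𝓡 1) z.2.1 z.2.1), z.2.2) := rfl
  rw [h, extChartAt_to_inv]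

theorem hasStrictFDerivAt_cylIncl (z : M × Circle × ℝ) (y : EuclideanSpace ℝ (Fin 4)) :
    HasStrictFDerivAt (cylIncl z) (ContinuousLinearMap.inl ℝ (EuclideanSpace ℝ (Fin 4))
      (EuclideanSpace ℝ (Fin 1) × ℝ)) y :=
  (hasStrictFDerivAt_id y).prodMk (hasStrictFDerivAt_const _ y)

theorem contDiff_cylIncl (z : M × Circle × ℝ) : ContDiff ℝ ∞ (cylIncl z) :=
  contDiff_prodMk_left _

/-- The tangent vectors of a horizontal section are tangent vectors of the threefold. -/
theorem mem_tangentSpaceOf_of_mem_crossSection {S : Set (M × Circle × ℝ)} {z : M × Circle × ℝ}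
    {v : TangentSpace (𝓡 4) z.1} (hv : v ∈ tangentSpaceOf (𝓡 4) {x | (x, z.2) ∈ S} z.1) :
    ((v, 0) : EuclideanSpace ℝ (Fin 4) × EuclideanSpace ℝ (Fin 1) × ℝ) ∈
      tangentSpaceOf cylModel S z := by
  let ι := ContinuousLinearMap.inl ℝ (EuclideanSpace ℝ (Fin 4)) (EuclideanSpace ℝ (Fin 1) × ℝ)
  suffices hle : tangentSpaceOf (𝓡 4) {x | (x, z.2) ∈ S} z.1 ≤
      Submodule.comap ι.toLinearMap (tangentSpaceOf cylModel S z) from hle hv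
  refine Submodule.span_le.2 fun w hw => Submodule.subset_span ?_
  have h1 := (hasStrictFDerivAt_cylIncl z
    (extChartAt (𝓡 4) z.1 z.1)).hasFDerivAt.hasFDerivWithinAt.mapsTo_tangent_cone hw
  refine tangentConeAt_mono ?_ h1
  rintro _ ⟨_, ⟨x, ⟨hxS, hx⟩, rfl⟩, rfl⟩
  refine ⟨(x, z.2), ⟨hxS, ?_⟩, rfl⟩
  rw [extChartAt_source] at hx ⊢
  exact ⟨hx, mem_chart_source _ z.2.1, trivial⟩

variable [IsManifold (𝓡 4) ∞ M]

/-- Suppose that a threefold contains `(x, z.2)` whenever it has a point over `x : M`. If at `z` its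
tangent space contains `∂t` and `dθ` vanishes on it, then its section through `z` is a surface near
`z`. The slice chart arises from one of the threefold by projecting along `∂t` in the product chart
at `z`. -/
theorem isSliceAt_crossSection {S : Set (M × Circle × ℝ)} {z : M × Circle × ℝ} (hz : z ∈ S)
    (hsl : IsSliceAt cylModel 3 S z) (hS : ∀ w ∈ S, (w.1, z.2) ∈ S)
    {u : Fin 3 → TangentSpace cylModel z} (hu : ∀ i, u i ∈ tangentSpaceOf cylModel S z)
    (hθ : ∀ i, cylDθ z (u i) = 0) (hli : ∀ c : Fin 3 → ℝ, ∑ i, c i • u i = 0 → ∀ i, c i = 0)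
    (ht : (cylVertical : TangentSpace cylModel z) ∈ tangentSpaceOf cylModel S z) :
    IsSliceAt (𝓡 4) 2 {x | (x, z.2) ∈ S} z.1 := by
  obtain ⟨φ, hφ, hzφ, V, hV3, hV⟩ := hsl
  have hc := IsManifold.chart_mem_maximalAtlas (I := cylModel) (n := ∞) z
  let c := extChartAt cylModel z
  let ψ := φ.extend cylModel ∘ c.symm
  let ψi := c ∘ (φ.extend cylModel).symm
  have hcz : z ∈ c.source := mem_extChartAt_source z
  have hczz : c.symm (c z) = z := c.left_inv hcz
  have hleft : ∀ w ∈ φ.source, (φ.extend cylModel).symm (φ.extend cylModel w) = w :=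
    fun w hw => φ.extend_left_inv hw
  have hψ : ∀ w ∈ φ.source, w ∈ c.source → ContDiffAt ℝ ∞ ψ (c w) := fun w hw hwc =>
    contDiffAt_extend_comp_extend_symm hc hφ (by simpa [c] using hwc) hw
  have hψi : ContDiffAt ℝ ∞ ψi (φ.extend cylModel z) :=
    contDiffAt_extend_comp_extend_symm hφ hc hzφ (mem_chart_source _ z)
  have hψz : ψ (c z) = φ.extend cylModel z := congrArg (φ.extend cylModel) hczz
  -- the two transition maps have inverse derivatives
  let D := fderiv ℝ ψ (c z)
  let D' := fderiv ℝ ψi (φ.extend cylModel z)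
  have hD : HasStrictFDerivAt ψ D (c z) := (hψ z hzφ hcz).hasStrictFDerivAt (by simp)
  have hD' : HasStrictFDerivAt ψi D' (φ.extend cylModel z) := hψi.hasStrictFDerivAt (by simp)
  have hnear : ∀ᶠ e in 𝓝 (c z), e ∈ c.target ∧ c.symm e ∈ φ.source := by
    refine Filter.Eventually.and (extChartAt_target_mem_nhds z) ?_
    refine (continuousAt_extChartAt_symm z).eventually ?_
    rw [extChartAt_to_inv]
    exact φ.open_source.mem_nhds hzφ
  have hcomp : ∀ᶠ e in 𝓝 (c z), ψi (ψ e) = e := by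
    filter_upwards [hnear] with e he
    simp only [ψ, ψi, Function.comp_apply, hleft _ he.2]
    exact c.right_inv he.1
  have hD'D : ∀ w, D' (D w) = w := by
    have h1 : HasFDerivAt (ψi ∘ ψ) (D'.comp D) (c z) :=
      HasFDerivAt.comp (c z) (by rw [hψz]; exact hD'.hasFDerivAt) hD.hasFDerivAt
    have h2 := h1.unique ((hasFDerivAt_id (c z)).congr_of_eventuallyEq hcomp)
    exact fun w => congrArg (fun f => f w) h2
  -- the tangent space in the preferred chart
  let u' : Fin 3 → EuclideanSpace ℝ (Fin 4) × EuclideanSpace ℝ (Fin 1) × ℝ := u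
  have hliu : LinearIndependent ℝ u' := Fintype.linearIndependent_iff.2 hli
  let T := Submodule.span ℝ (range u')
  have hT3 : Module.finrank ℝ T = 3 := by simpa using finrank_span_eq_card hliu
  have hDT : T.map D.toLinearMap = V := by
    refine Submodule.eq_of_le_of_finrank_eq ?_ ?_
    · rw [Submodule.map_le_iff_le_comap, Submodule.span_le]
      rintro _ ⟨i, rfl⟩
      exact fderiv_extend_mem_of_mem_tangentSpaceOf hφ hV hzφ hz (hu i)
    · have hinj : Function.Injective D.toLinearMap :=
        Function.LeftInverse.injective (g := D') hD'D
      rw [hV3, ← (Submodule.equivMapOfInjective D.toLinearMap hinj T).finrank_eq, hT3]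
  have hVT : V.map D'.toLinearMap = T := by
    rw [← hDT]
    ext w
    constructor
    · rintro ⟨_, ⟨v, hv, rfl⟩, rfl⟩
      have : D' (D v) ∈ T := by rwa [hD'D]
      exact this
    · exact fun hw => ⟨D w, ⟨w, hw, rfl⟩, hD'D w⟩
  have htT : ((0, 0, 1) : EuclideanSpace ℝ (Fin 4) × EuclideanSpace ℝ (Fin 1) × ℝ) ∈ T := by
    rw [← hVT]
    exact ⟨D cylVertical, fderiv_extend_mem_of_mem_tangentSpaceOf hφ hV hzφ hz ht, hD'D _⟩
  have hT0 : ∀ w ∈ T, w.2.1 = 0 := by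
    have : T ≤ LinearMap.ker (LinearMap.fst ℝ (EuclideanSpace ℝ (Fin 1)) ℝ ∘ₗ
        LinearMap.snd ℝ (EuclideanSpace ℝ (Fin 4)) (EuclideanSpace ℝ (Fin 1) × ℝ)) := by
      rw [Submodule.span_le]
      rintro _ ⟨i, rfl⟩
      exact (cylDθ_eq_zero_iff z (u i)).1 (hθ i)
    exact fun w hw => this hw
  have hfin := finrank_map_fst_of_vertical_mem hT3 hT0 htT
  -- the section and the retraction that the two transition maps define
  let j := ψ ∘ cylIncl z
  let r := fun v => (ψi v).1
  let r' := (ContinuousLinearMap.fst ℝ (EuclideanSpace ℝ (Fin 4))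
    (EuclideanSpace ℝ (Fin 1) × ℝ)).comp D'
  have hincl : cylIncl z (chartAt (EuclideanSpace ℝ (Fin 4)) z.1 z.1) = c z := rfl
  have hj : HasStrictFDerivAt j (D.comp (ContinuousLinearMap.inl ℝ _ _))
      (chartAt (EuclideanSpace ℝ (Fin 4)) z.1 z.1) :=
    HasStrictFDerivAt.comp (g := ψ) (f := cylIncl z) _ (by rwa [hincl])
      (hasStrictFDerivAt_cylIncl z _)
  have hjz : j (chartAt (EuclideanSpace ℝ (Fin 4)) z.1 z.1) = φ.extend cylModel z := hψz
  have hr : HasStrictFDerivAt r r' (j (chartAt (EuclideanSpace ℝ (Fin 4)) z.1 z.1)) := by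
    rw [hjz]
    exact (ContinuousLinearMap.fst ℝ _ _).hasStrictFDerivAt.comp _ hD'
  have hinclc : Continuous (cylIncl z) := (contDiff_cylIncl z).continuous
  have hnear' : ∀ᶠ y in 𝓝 (chartAt (EuclideanSpace ℝ (Fin 4)) z.1 z.1),
      cylIncl z y ∈ c.target ∧ c.symm (cylIncl z y) ∈ φ.source :=
    hinclc.continuousAt.eventually hnear
  have hrj : ∀ᶠ y in 𝓝 (chartAt (EuclideanSpace ℝ (Fin 4)) z.1 z.1), r (j y) = y := by
    filter_upwards [hinclc.continuousAt.eventually hcomp] with y hy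
    exact congrArg Prod.fst hy
  have hk : HasFDerivAt (fun y => r' (j y)) ((ContinuousLinearEquiv.refl ℝ
      (EuclideanSpace ℝ (Fin 4)) : _ ≃L[ℝ] _) : _ →L[ℝ] _)
      (chartAt (EuclideanSpace ℝ (Fin 4)) z.1 z.1) := by
    refine (r'.hasFDerivAt.comp _ hj.hasFDerivAt).congr_fderiv ?_
    ext1 w
    exact congrArg Prod.fst (hD'D (w, 0))
  refine isSliceAt_of_eventually (k := fun y => r' (j y)) ?_ hk (V := V.map r'.toLinearMap) ?_
    (eventually_mem_iff_fderiv_mem_map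
      (N := {y | (chartAt (EuclideanSpace ℝ (Fin 4)) z.1).symm y ∈ {x | (x, z.2) ∈ S}})
      hj hr hrj ?_ ?_ ?_)
  · filter_upwards [hnear'] with y hy
    have h1 := hψ _ hy.2 (c.map_target hy.1)
    rw [c.right_inv hy.1] at h1
    exact r'.contDiff.contDiffAt.comp y (h1.comp y (contDiff_cylIncl z).contDiffAt)
  · rw [← hVT, ← Submodule.map_comp] at hfin
    exact hfin
  · rw [hjz]
    exact (hV z hzφ).1 hz
  · filter_upwards [hnear'] with y hy
    have h1 := hV _ hy.2
    rw [extChartAt_symm_cylIncl] at h1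
    have h2 : j y = φ.extend cylModel ((extChartAt (𝓡 4) z.1).symm y, z.2) :=
      congrArg (φ.extend cylModel) (extChartAt_symm_cylIncl z y)
    rw [h2]
    exact h1
  · rw [hjz]
    have h1 : ∀ᶠ v in 𝓝 (φ.extend cylModel z), v ∈ (φ.extend cylModel).target :=
      (φ.isOpen_extend_target (I := cylModel)).mem_nhds
        ((φ.extend cylModel).map_source (by rwa [φ.extend_source]))
    have h2 : ∀ᶠ v in 𝓝 (φ.extend cylModel z), (φ.extend cylModel).symm v ∈ c.source := by
      refine (φ.continuousAt_extend_symm hzφ).eventually ?_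
      rw [hleft z hzφ]
      exact extChartAt_source_mem_nhds z
    filter_upwards [h1, h2] with v hv hvc hvV
    have hvφ : (φ.extend cylModel).symm v ∈ φ.source := by
      have := (φ.extend cylModel).map_target hv
      rwa [φ.extend_source] at this
    have hvS : (φ.extend cylModel).symm v ∈ S := by
      rw [hV _ hvφ, (φ.extend cylModel).right_inv hv]
      exact hvV
    rw [extChartAt_source] at hvc
    change ((chartAt (EuclideanSpace ℝ (Fin 4)) z.1).symm
      (chartAt (EuclideanSpace ℝ (Fin 4)) z.1 ((φ.extend cylModel).symm v).1), z.2) ∈ S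
    rw [(chartAt (EuclideanSpace ℝ (Fin 4)) z.1).left_inv hvc.1]
    exact hS _ hvS

end CrossSection

/-! ### Rigidity -/

section Rigidity

variable {M : Type*} [TopologicalSpace M] [ChartedSpace (EuclideanSpace ℝ (Fin 4)) M]
  [IsManifold (𝓡 4) ∞ M]

/-- On a special Lagrangian with `∂t` as a tangent vector, the contraction of `Im Ω` with `∂t` is
`κK` on the horizontal section, and `ω` is `κI`. -/
theorem κI_eq_zero_and_κK_eq_zero_of_crossSection (h : HyperkahlerStructure M)
    {S : Set (M × Circle × ℝ)} (hS : IsSpecialLagrangianThreefold h S) {z : M × Circle × ℝ}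
    (hz : z ∈ S) (ht : (cylVertical : TangentSpace cylModel z) ∈ tangentSpaceOf cylModel S z)
    {u v : TangentSpace (𝓡 4) z.1} (hu : u ∈ tangentSpaceOf (𝓡 4) {x | (x, z.2) ∈ S} z.1)
    (hv : v ∈ tangentSpaceOf (𝓡 4) {x | (x, z.2) ∈ S} z.1) :
    h.κI z.1 ![u, v] = 0 ∧ h.κK z.1 ![u, v] = 0 := by
  let u' : TangentSpace cylModel z :=
    ((u, 0) : EuclideanSpace ℝ (Fin 4) × EuclideanSpace ℝ (Fin 1) × ℝ)
  let v' : TangentSpace cylModel z :=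
    ((v, 0) : EuclideanSpace ℝ (Fin 4) × EuclideanSpace ℝ (Fin 1) × ℝ)
  let t' : TangentSpace cylModel z := cylVertical
  have hu' : u' ∈ tangentSpaceOf cylModel S z := mem_tangentSpaceOf_of_mem_crossSection hu
  have hv' : v' ∈ tangentSpaceOf cylModel S z := mem_tangentSpaceOf_of_mem_crossSection hv
  have hpu : cylProj z u' = u := cylProj_eq z u'
  have hpv : cylProj z v' = v := cylProj_eq z v'
  have htu : cylDt z u' = 0 := cylDt_eq z u'
  have htv : cylDt z v' = 0 := cylDt_eq z v'
  have htt : cylDt z t' = 1 := cylDt_eq z t'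
  have hθu : cylDθ z u' = 0 := (cylDθ_eq_zero_iff z u').2 rfl
  have hθv : cylDθ z v' = 0 := (cylDθ_eq_zero_iff z v').2 rfl
  have hθt : cylDθ z t' = 0 := (cylDθ_eq_zero_iff z t').2 rfl
  obtain ⟨h1, h2⟩ := hS.2 z hz ![u', v', t'] (by
    intro i
    fin_cases i
    exacts [hu', hv', ht])
  rw [im_cylVolumeForm] at h2
  change h.κI z.1 ![cylProj z u', cylProj z v'] +
    (cylDt z u' * cylDθ z v' - cylDt z v' * cylDθ z u') = 0 at h1
  change h.κK z.1 ![cylProj z u', cylProj z v'] * cylDt z t' -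
      h.κK z.1 ![cylProj z u', cylProj z t'] * cylDt z v' +
      h.κK z.1 ![cylProj z v', cylProj z t'] * cylDt z u' +
    (h.κJ z.1 ![cylProj z u', cylProj z v'] * cylDθ z t' -
      h.κJ z.1 ![cylProj z u', cylProj z t'] * cylDθ z v' +
      h.κJ z.1 ![cylProj z v', cylProj z t'] * cylDθ z u') = 0 at h2
  rw [htu, htv, hpu, hpv] at h1
  rw [htu, htv, htt, hθu, hθv, hθt, hpu, hpv] at h2
  constructor
  · linarith
  · linarith

end Rigidity

theorem lemma5p2 {M : Type*} [TopologicalSpace M] [T2Space M] [CompactSpace M]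
    [SimplyConnectedSpace M] [ChartedSpace (EuclideanSpace ℝ (Fin 4)) M] [IsManifold (𝓡 4) ∞ M]
    (h : HyperkahlerStructure M) (a b : ℝ) (hab : a < b) (p : Circle) (N : Set M)
    (hL : IsSpecialLagrangianThreefold h (N ×ˢ ({p} : Set Circle) ×ˢ Set.Icc a b))
    (L' : Set (M × Circle × ℝ)) (hL' : IsSpecialLagrangianThreefold h L')
    (hhom : HomologousRel cylModel 2 (cylReΩ h)
      (Set.univ ×ˢ (Set.univ : Set Circle) ×ˢ Set.Icc a b)
      (Set.univ ×ˢ ({p} : Set Circle) ×ˢ ({a, b} : Set ℝ))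
      (N ×ˢ ({p} : Set Circle) ×ˢ Set.Icc a b) L') :
    ∃ N' : Set M, IsSpecialLagrangianSurface h N' ∧
      L' = N' ×ˢ ({p} : Set Circle) ×ˢ Set.Icc a b := by
  obtain ⟨-, hX, -, hA, c, c', hc, hc', W, hW, hcW⟩ := hhom
  have hint : chainIntegral h c' = 0 := by
    refine chainIntegral_eq_zero h (S := N ×ˢ ({p} : Set Circle) ×ˢ Icc a b) (fun z hz => hz.2.1)
      (fun z hz => hz.2.1) (fun σ hσ => ⟨(hc.1 σ hσ).1, ?_⟩) hW hcW
    rw [← hc.2.2.1]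
    exact subset_biUnion_of_mem (u := fun σ : (Fin 3 → unitInterval) → M × Circle × ℝ => range σ) hσ
  have htan := exists_tangent_basis_of_chainIntegral_eq_zero h hL' hc' hint
  have ht : ∀ z ∈ L', (cylVertical : TangentSpace cylModel z) ∈ tangentSpaceOf cylModel L' z :=
    fun z hz => by
      obtain ⟨-, -, -, -, hz'⟩ := htan z hz
      exact hz'
  have hseg := segment_subset_of_cylVertical_mem hab hc'.isCompact.isClosed hX hA hL'.1 ht
  -- the section is taken at an interior time, where `L'` has no boundary
  have hmid : (a + b) / 2 ∈ Ioo a b := by constructor <;> linarith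
  refine ⟨{x | (x, p, (a + b) / 2) ∈ L'}, ⟨fun x hx => ?_, fun x hx u hu v hv => ?_⟩, ?_⟩
  · obtain ⟨u, hu, hθ, hli, htx⟩ := htan _ hx
    refine isSliceAt_crossSection (z := (x, p, (a + b) / 2)) hx ?_ ?_ hu hθ hli htx
    · refine (hL'.1 _ hx).resolve_right fun hh => ?_
      rcases (hA ⟨hx, hh⟩).2.2 with h1 | h1
      · exact hmid.1.ne' h1
      · exact hmid.2.ne h1
    · intro w hw
      obtain ⟨hp, hI⟩ := hseg w hw
      have := hI _ (Ioo_subset_Icc_self hmid)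
      rwa [hp] at this
  · exact κI_eq_zero_and_κK_eq_zero_of_crossSection h hL' (z := (x, p, (a + b) / 2)) hx (ht _ hx)
      hu hv
  · ext ⟨x, q, t⟩
    constructor
    · intro hz
      obtain ⟨hp, hI⟩ := hseg _ hz
      have hq : q = p := hp
      subst hq
      exact ⟨hI _ (Ioo_subset_Icc_self hmid), rfl, (hX hz).2.2⟩
    · rintro ⟨hx, hq, htI⟩
      have hq' : q = p := hq
      subst hq'
      exact (hseg _ hx).2 t htI
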